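/- Let $\mathbf{k}$ be a field of characteristic $0$ and let $A,B$ be $\mathbb{Z}$-graded $\mathbf{k}$-vector spaces. Let $(sA)^e=A^{e+1}$ be the suspension, and $s^{-1}$ the desuspension (which raises degrees by one). All signs follow the Koszul rule, and differentials have degree $+1$. Put $$\mathfrak g=\prod_{m>0}\mathrm{Hom}((sA)^{\otimes m},sA),\qquad \mathfrak h=\prod_{m>0}\mathrm{Hom}((sB)^{\otimes m},sB),\qquad \Psi=\prod_{m>0}\Psi_m,\quad \Psi_m=\mathrm{Hom}((sA)^{\otimes m},sB)$$ (graded $\mathrm{Hom}$, products taken degreewise). For $g\in\mathfrak g$ and $f\in\mathfrak g$ or $f\in\Psi$, let $f\circ\widehat g$ be given by $(f\circ\widehat g)(a_1,\dots,a_N)=\sum_{r,t}(-1)^{g(a_1+\dots+a_r)}f(a_1,\dots,a_r,g(a_{r+1},\dots,a_{r+t}),a_{r+t+1},\dots,a_N)$, where $t\ge1$, and similarly for $\mathfrak h$. For $h\in\mathfrak h$ and $\psi_1,\dots,\psi_t\in\Psi$ let $h\circ(\psi_1\otimes\dots\otimes\psi_t)\in\Psi$ be the composition, in which the arguments are distributed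 into $t$ nonempty consecutive blocks in all possible ways. For $\psi\in\Psi$ of degree $0$ let $h\circ\widetilde\psi=\sum_{t>0}h\circ\psi^{\otimes t}$. An $A_\infty$-structure on $A$ is an element $\alpha\in\mathfrak g$ of degree $1$ with $\alpha\circ\widehat\alpha=0$; an $A_\infty$-structure on $B$ is an element $\beta\in\mathfrak h$ of degree $1$ with $\beta\circ\widehat\beta=0$; an $A_\infty$-morphism $(A,\alpha)\to(B,\beta)$ is an element $\psi\in\Psi$ of degree $0$ with $\psi\circ\widehat\alpha=\beta\circ\widetilde\psi$. Let $T^c(\Psi)=\bigoplus_{n>0}\Psi^{\otimes n}$, and let $\overline\Gamma=\bigoplus_{p>0}\overline\Gamma_p$ be its completed cobar construction: $\overline\Gamma_p$ is the completion of $(s^{-1}T^c(\Psi))^{\otimes p}$ with respect to the tensor powers of $\Psi$ and the arities of the factors, i.e. (degreewise) $$\overline\Gamma_p=\prod_{n_1,\dots,n_p>0}\ \prod_{m_1,\dots,m_n>0} s^{-1}(\Psi_{m_1}\otimes\dots\otimes\Psi_{m_{n_1}})\otimes\dots\otimes s^{-1}(\Psi_{m_{n-n_p+1}}\otimes\dots\otimes\Psi_{m_n}),\qquad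 n=n_1+\dots+n_p .$$ Its product is the tensor product, and its differential $\delta$ is the derivation with $$\delta(s^{-1}(\psi_1,\dots,\psi_n))=\sum_{i=1}^{n-1}(-1)^{\psi_1+\dots+\psi_i+1}s^{-1}(\psi_1,\dots,\psi_i)\otimes s^{-1}(\psi_{i+1},\dots,\psi_n).$$ Let $\mathfrak h$ act on $\overline\Gamma$ from the left and $\mathfrak g$ from the right by the (left, respectively right) derivations with $$h\cdot s^{-1}(\psi_1,\dots,\psi_n)=\sum_{i\ge 0,\,t>0}(-1)^{h(\psi_1+\dots+\psi_i)}s^{-1}(\psi_1,\dots,\psi_i,\,h\circ(\psi_{i+1}\otimes\dots\otimes\psi_{i+t}),\,\psi_{i+t+1},\dots,\psi_n),$$ $$s^{-1}(\psi_1,\dots,\psi_n)\cdot g=(-1)^{g}\sum_{i}(-1)^{g(\psi_{i+1}+\dots+\psi_n)}s^{-1}(\psi_1,\dots,\psi_i\circ\widehat g,\dots,\psi_n).$$ Let $L(A,B)=\overline\Gamma\oplus\mathfrak g\oplus\mathfrak h$, with the differential $d$ that equals $\delta$ on $\overline\Gamma$ and $0$ on $\mathfrak g\oplus\mathfrak h$,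 and the bracket $[x,y]=\mathfrak b_{1,1}(x,y)+(-1)^{xy+1}\mathfrak b_{1,1}(y,x)$, where $$\mathfrak b_{1,1}(\gamma+g+h,\ \gamma'+g'+h')=\bigl(\gamma\gamma'+h\cdot\gamma'+\gamma\cdot g'\bigr)+g\circ\widehat{g'}+h\circ\widehat{h'} .$$ **Proposition.** The map $$(\alpha,\beta,\psi)\longmapsto \alpha+\beta+\sum_{n>0}s^{-1}(\psi^{\otimes n})$$ is a bijection from the set of triples consisting of an $A_\infty$-structure $\alpha$ on $A$, an $A_\infty$-structure $\beta$ on $B$ and an $A_\infty$-morphism $\psi:(A,\alpha)\to(B,\beta)$ onto the set of solutions of the Maurer–Cartan equation in $L(A,B)$, i.e. of the elements $l\in L(A,B)$ of degree $1$ with $d\,l+\tfrac12[l,l]=0$. -/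

import Mathlib

open scoped TensorProduct DirectSum

noncomputable section

namespace AInfMor

universe u v w z

/-!
Conventions. A graded `k`-space is a `k`-module `A` with a decomposition `𝒜 : ℤ → Submodule k A`.
Its suspension `sA` is the same module with `(sA)^e = A^(e+1)`, so that the suspension lowers
degrees by one, and the desuspension raises them by one.
All differentials raise the degree by one, and all signs follow the Koszul rule.
-/

section Multilinear

variable {k : Type u} [CommRing k]
variable {X : Type v} [AddCommGroup X] [Module k X]
variable {Y : Type w} [AddCommGroup Y] [Module k Y]
variable {Z : Type z} [AddCommGroup Z] [Module k Z]

/-- The word of length `n` obtained from the word `x` of length `N = n + s - 1` by applying `F`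
to the `s` consecutive letters in the positions `i, …, i + s - 1`, and `T` to the letters that
precede them: `T x₀, …, T xᵢ₋₁, F (xᵢ, …, xᵢ₊ₛ₋₁), xᵢ₊ₛ, …`. -/
def spliceWord {N n s : ℕ} (h : n + s = N + 1) (i : Fin n) (T : X →ₗ[k] X)
    (F : MultilinearMap k (fun _ : Fin s => X) X) (x : Fin N → X) : Fin n → X := fun j =>
  if h1 : j < i then T (x ⟨j, by have := i.2; have : j.1 < i.1 := h1; omega⟩)
  else if h2 : i < j then
    x ⟨j + s - 1, by have := j.2; have : i.1 < j.1 := h2; omega⟩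
  else F (fun l : Fin s => x ⟨i + l, by have := i.2; have := l.2; omega⟩)

theorem spliceWord_update {N n s : ℕ} (h : n + s = N + 1) (i : Fin n) (T : X →ₗ[k] X)
    (F : MultilinearMap k (fun _ : Fin s => X) X) [DecidableEq (Fin N)] (x : Fin N → X)
    (p : Fin N) : ∃ (q : Fin n) (φ : X →ₗ[k] X), ∀ a : X,
      spliceWord h i T F (Function.update x p a)
        = Function.update (spliceWord h i T F x) q (φ a) := by
  have hi := i.2
  have hp := p.2
  rcases lt_or_ge p.1 i.1 with hlt | hge
  · refine ⟨⟨p, by omega⟩, T, fun a => ?_⟩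
    funext j
    by_cases hj : j = ⟨p, by omega⟩
    · subst hj
      have h1 : (⟨p.1, by omega⟩ : Fin n) < i := hlt
      simp [spliceWord, h1]
    · have hj' : j.1 ≠ p.1 := fun hh => hj (Fin.ext hh)
      rw [Function.update_of_ne hj]
      unfold spliceWord
      split_ifs with h1 h2
      · rw [Function.update_of_ne]
        intro hh; exact hj' (congrArg Fin.val hh)
      · rw [Function.update_of_ne]
        intro hh
        have := congrArg Fin.val hh
        have h2' : i.1 < j.1 := h2
        simp only at this
        omega
      · congr 1
        funext l
        rw [Function.update_of_ne]
        intro hh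
        have := congrArg Fin.val hh
        simp only at this
        omega
  · rcases lt_or_ge p.1 (i.1 + s) with hlt2 | hge2
    · refine ⟨i, F.toLinearMap
        (fun l : Fin s => x ⟨i + l, by have := l.2; omega⟩) ⟨p.1 - i.1, by omega⟩, fun a => ?_⟩
      funext j
      by_cases hj : j = i
      · subst hj
        simp only [spliceWord, lt_self_iff_false, dite_false, Function.update_self,
          MultilinearMap.toLinearMap_apply]
        congr 1
        funext l
        by_cases hl : l = ⟨p.1 - j.1, by omega⟩
        · have : (⟨j.1 + l.1, by have := l.2; omega⟩ : Fin N) = p := by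
            apply Fin.ext
            simp [hl]; omega
          rw [this, Function.update_self, hl, Function.update_self]
        · rw [Function.update_of_ne, Function.update_of_ne hl]
          intro hh
          have := congrArg Fin.val hh
          apply hl
          apply Fin.ext
          simp only at this ⊢
          omega
      · rw [Function.update_of_ne hj]
        have hj' : j.1 ≠ i.1 := fun hh => hj (Fin.ext hh)
        unfold spliceWord
        split_ifs with h1 h2
        · rw [Function.update_of_ne]
          intro hh
          have := congrArg Fin.val hh
          have h1' : j.1 < i.1 := h1
          simp only at this
          omega
        · rw [Function.update_of_ne]
          intro hh
          have := congrArg Fin.val hh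
          have h2' : i.1 < j.1 := h2
          simp only at this
          omega
        · exfalso
          have h1' : ¬ j.1 < i.1 := h1
          have h2' : ¬ i.1 < j.1 := h2
          omega
    · refine ⟨⟨p.1 + 1 - s, by omega⟩, LinearMap.id, fun a => ?_⟩
      funext j
      by_cases hj : j = ⟨p.1 + 1 - s, by omega⟩
      · have hjv : j.1 = p.1 + 1 - s := congrArg Fin.val hj
        rw [hj, Function.update_self, ← hj]
        unfold spliceWord
        split_ifs with h1 h2
        · exfalso
          have h1' : j.1 < i.1 := h1
          omega
        · have : (⟨j.1 + s - 1, by have := j.2; have : i.1 < j.1 := h2; omega⟩ : Fin N) = p := by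
            apply Fin.ext
            simp only
            omega
          rw [this, Function.update_self]
          rfl
        · exfalso
          have h2' : ¬ i.1 < j.1 := h2
          omega
      · have hj' : j.1 ≠ p.1 + 1 - s := fun hh => hj (Fin.ext hh)
        rw [Function.update_of_ne hj]
        unfold spliceWord
        split_ifs with h1 h2
        · rw [Function.update_of_ne]
          intro hh
          have := congrArg Fin.val hh
          have h1' : j.1 < i.1 := h1
          simp only at this
          omega
        · rw [Function.update_of_ne]
          intro hh
          have := congrArg Fin.val hh
          have h2' : i.1 < j.1 := h2
          simp only at this
          omega
        · congr 1
          funext l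
          have := l.2
          rw [Function.update_of_ne]
          intro hh
          have := congrArg Fin.val hh
          simp only at this
          omega

/-- The multilinear map `G ∘ (T ⊗ … ⊗ T ⊗ F ⊗ id ⊗ … ⊗ id)`, with `F` in position `i`. -/
def splice {N n s : ℕ} (h : n + s = N + 1) (i : Fin n) (T : X →ₗ[k] X)
    (F : MultilinearMap k (fun _ : Fin s => X) X)
    (G : MultilinearMap k (fun _ : Fin n => X) Y) :
    MultilinearMap k (fun _ : Fin N => X) Y where
  toFun x := G (spliceWord h i T F x)
  map_update_add' x p a b := by
    obtain ⟨q, φ, hq⟩ := spliceWord_update h i T F x p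
    simp only [hq, map_add, MultilinearMap.map_update_add]
  map_update_smul' x p c a := by
    obtain ⟨q, φ, hq⟩ := spliceWord_update h i T F x p
    simp only [hq, map_smul, MultilinearMap.map_update_smul]

theorem blocks_update {N : ℕ} (c : Composition N)
    (f : ∀ j : Fin c.length, MultilinearMap k (fun _ : Fin (c.blocksFun j) => X) Y)
    [inst : DecidableEq (Fin N)] (x : Fin N → X) (p : Fin N) (a : X) :
    (fun j => f j (Function.update x p a ∘ c.embedding j))
      = Function.update (fun j => f j (x ∘ c.embedding j)) (c.index p)
          (f (c.index p) (Function.update (x ∘ c.embedding (c.index p)) (c.invEmbedding p) a)) := by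
  obtain rfl : inst = instDecidableEqFin N := Subsingleton.elim _ _
  funext j
  by_cases h : j = c.index p
  · subst h
    rw [Function.update_self]
    congr 1
    have := Function.update_comp_eq_of_injective x (c.embedding (c.index p)).injective
      (c.invEmbedding p) a
    rw [← this, c.embedding_comp_inv p]
  · rw [Function.update_of_ne h]
    congr 1
    apply Function.update_comp_eq_of_notMem_range
    rwa [c.mem_range_embedding_iff']

/-- For a composition `c = (c₁, …, cᵣ)` of `N`, the map `g ∘ (f₁ ⊗ … ⊗ fᵣ)`, where `fⱼ` takes the
`j`-th block, of length `cⱼ`, of the `N` arguments (no signs are inserted). -/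
def blockComp {N : ℕ} (c : Composition N) (g : MultilinearMap k (fun _ : Fin c.length => Y) Z)
    (f : ∀ j : Fin c.length, MultilinearMap k (fun _ : Fin (c.blocksFun j) => X) Y) :
    MultilinearMap k (fun _ : Fin N => X) Z where
  toFun x := g (fun j => f j (x ∘ c.embedding j))
  map_update_add' x p a b := by
    simp only [blocks_update, MultilinearMap.map_update_add]
  map_update_smul' x p t a := by
    simp only [blocks_update, MultilinearMap.map_update_smul]

variable (k X Y) in
/-- Families of multilinear maps, one for each arity. -/
abbrev Cochain : Type (max v w) := ∀ m : ℕ, MultilinearMap k (fun _ : Fin m => X) Y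

/-- `h ∘ (ψ₁ ⊗ … ⊗ ψₛ)` without signs, for a cochain `h` and `s` cochains `ψ₁, …, ψₛ`: in arity `N`
it is the sum over all the ways to cut the `N` arguments into `s` nonempty consecutive blocks. -/
def plainComp (h : Cochain k Y Z) (s : ℕ) :
    MultilinearMap k (fun _ : Fin s => Cochain k X Y) (Cochain k X Z) where
  toFun ψ := fun N => ∑ c : {c : Composition N // c.length = s},
    blockComp c.1 (h c.1.length) (fun j => ψ (Fin.cast c.2 j) (c.1.blocksFun j))
  map_update_add' ψ p a b := by
    funext N
    simp only [Pi.add_apply, ← Finset.sum_add_distrib]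
    refine Finset.sum_congr rfl fun c _ => ?_
    obtain ⟨c, rfl⟩ := c
    ext x
    have key : ∀ a : Cochain k X Y,
        (fun j => (Function.update ψ p a (Fin.cast rfl j) (c.blocksFun j)) (x ∘ c.embedding j))
        = Function.update (fun j => (ψ j (c.blocksFun j)) (x ∘ c.embedding j)) p
            (a (c.blocksFun p) (x ∘ c.embedding p)) := by
      intro a
      funext j
      by_cases hj : j = p
      · subst hj; simp
      · simp [hj]
    simp only [blockComp, MultilinearMap.coe_mk, add_apply, key, Pi.add_apply,
      MultilinearMap.map_update_add]
  map_update_smul' ψ p t a := by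
    funext N
    simp only [Pi.smul_apply, Finset.smul_sum]
    refine Finset.sum_congr rfl fun c _ => ?_
    obtain ⟨c, rfl⟩ := c
    ext x
    have key : ∀ a : Cochain k X Y,
        (fun j => (Function.update ψ p a (Fin.cast rfl j) (c.blocksFun j)) (x ∘ c.embedding j))
        = Function.update (fun j => (ψ j (c.blocksFun j)) (x ∘ c.embedding j)) p
            (a (c.blocksFun p) (x ∘ c.embedding p)) := by
      intro a
      funext j
      by_cases hj : j = p
      · subst hj; simp
      · simp [hj]
    simp only [blockComp, MultilinearMap.coe_mk, smul_apply, key, Pi.smul_apply,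
      MultilinearMap.map_update_smul]

end Multilinear

section Graded

set_option linter.unusedSectionVars false

variable {k : Type u} [Field k]
variable {A : Type v} [AddCommGroup A] [Module k A]
variable {B : Type w} [AddCommGroup B] [Module k B]
variable (𝒜 : ℤ → Submodule k A) [DirectSum.Decomposition 𝒜]
variable (ℬ : ℤ → Submodule k B) [DirectSum.Decomposition ℬ]

variable (k) in
/-- The sign `(-1)^n`, as a scalar. -/
def sgn (n : ℤ) : k := ((n.negOnePow : ℤˣ) : ℤ)

/-- The sign operator of `sA`: it multiplies `(sA)^e = A^(e+1)` by `(-1)^(j e)`, the sign produced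
by moving an element of degree `j` past an element of `sA`. -/
def koszul (j : ℤ) : A →ₗ[k] A :=
  DirectSum.toModule k ℤ A (fun e => sgn k (j * (e - 1)) • (𝒜 e).subtype) ∘ₗ
    (DirectSum.decomposeLinearEquiv 𝒜).toLinearMap

/-- The maps `(sA)^{⊗ m} → sB` that raise the degree by `d`. -/
def homDeg (m : ℕ) (d : ℤ) : Submodule k (MultilinearMap k (fun _ : Fin m => A) B) where
  carrier := {f | ∀ (e : Fin m → ℤ) (x : Fin m → A), (∀ i, x i ∈ 𝒜 (e i + 1)) →
    f x ∈ ℬ ((∑ i, e i) + d + 1)}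
  zero_mem' := fun _ _ _ => zero_mem _
  add_mem' hf hg := fun e x hx => add_mem (hf e x hx) (hg e x hx)
  smul_mem' c _ hf := fun e x hx => Submodule.smul_mem _ c (hf e x hx)

/-- The elements of degree `d` of the graded space `∏_{m>0} Hom((sA)^{⊗ m}, sB)`. -/
def cochainDeg (d : ℤ) : Submodule k (Cochain k A B) where
  carrier := {f | f 0 = 0 ∧ ∀ m, f m ∈ homDeg 𝒜 ℬ m d}
  zero_mem' := ⟨rfl, fun _ => zero_mem _⟩
  add_mem' hf hg := ⟨by simp [hf.1, hg.1], fun m => add_mem (hf.2 m) (hg.2 m)⟩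
  smul_mem' c _ hf := ⟨by simp [hf.1], fun m => Submodule.smul_mem _ c (hf.2 m)⟩

/-- `ψ ∘ α̂`, where `α` has degree `d` and `α̂` is the coderivation of the tensor coalgebra of `sA`
cogenerated by `α`: the value on `(a₁, …, a_N)` is the sum over all `1 ≤ s ≤ N` and `r` of
`± ψ (a₁, …, aᵣ, α (aᵣ₊₁, …, aᵣ₊ₛ), aᵣ₊ₛ₊₁, …, a_N)`, with the sign `(-1)^{d (a₁ + … + aᵣ)}`. -/
def brace (d : ℤ) (α : Cochain k A A) : Cochain k A B →ₗ[k] Cochain k A B where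
  toFun ψ := fun N => ∑ q : Fin N, ∑ r : Fin (N - q),
    splice (by have := q.2; omega : N - q + (q + 1) = N + 1) r (koszul 𝒜 d) (α (q + 1)) (ψ (N - q))
  map_add' f g := by
    funext N
    simp only [Pi.add_apply, ← Finset.sum_add_distrib]
    rfl
  map_smul' c f := by
    funext N
    simp only [Pi.smul_apply, Finset.smul_sum, RingHom.id_apply]
    rfl

/-- `β ∘ ψ̃`, where `ψ` has degree `0` and `ψ̃` is the morphism of tensor coalgebras cogenerated by
`ψ`: the value on `(a₁, …, a_N)` is the sum of `β (ψ (a₁, …, a_{i₁}), …, ψ (…, a_N))` over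
all the ways to cut the arguments into nonempty consecutive blocks. -/
def compTilde (β : Cochain k B B) (ψ : Cochain k A B) : Cochain k A B := fun N =>
  ∑ c : Composition N, blockComp c (β c.length) (fun j => ψ (c.blocksFun j))

/-- `A_∞`-structures on `A`: families of maps `αₘ : (sA)^{⊗ m} → sA`, `m ≥ 1`, of degree one with
`∑ αₙ ∘ (1 ⊗ … ⊗ αₛ ⊗ … ⊗ 1) = 0` in each arity. -/
def IsAInfAlgebra (α : Cochain k A A) : Prop :=
  α ∈ cochainDeg 𝒜 𝒜 1 ∧ brace 𝒜 1 α α = 0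

/-- `A_∞`-morphisms from `(A, α)` to `(B, β)`: families of maps `ψₘ : (sA)^{⊗ m} → sB`, `m ≥ 1`,
of degree zero with `ψ ∘ α̂ = β ∘ ψ̃`. -/
def IsAInfMorphism (α : Cochain k A A) (β : Cochain k B B) (ψ : Cochain k A B) : Prop :=
  ψ ∈ cochainDeg 𝒜 ℬ 0 ∧ brace 𝒜 1 α ψ = compTilde β ψ

/-- Triples of an `A_∞`-structure on `A`, an `A_∞`-structure on `B`, and an `A_∞`-morphism from
the first to the second. -/
structure AInfTriple where
  α : Cochain k A A
  β : Cochain k B B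
  ψ : Cochain k A B
  isAlgebra_α : IsAInfAlgebra 𝒜 α
  isAlgebra_β : IsAInfAlgebra ℬ β
  isMorphism_ψ : IsAInfMorphism 𝒜 ℬ α β ψ

/-! ### The completed cobar construction -/

/-- The sign operator of `∏_{m>0} Hom((sA)^{⊗ m}, sB)`: it multiplies cochains of degree `d` by
`(-1)^(j d)`. -/
def tau (j : ℤ) : Cochain k A B →ₗ[k] Cochain k A B where
  toFun f := fun m => (koszul ℬ j).compMultilinearMap ((f m).compLinearMap fun _ => koszul 𝒜 j)
  map_add' f g := by funext m; ext x; simp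
  map_smul' c f := by funext m; ext x; simp

/-- Applies `koszul 𝒜 j` to all arguments of a cochain. -/
def signIn (j : ℤ) : Cochain k A B →ₗ[k] Cochain k A B where
  toFun f := fun m => (f m).compLinearMap fun _ => koszul 𝒜 j
  map_add' f g := by funext m; ext x; simp
  map_smul' c f := by funext m; ext x; simp

/-- The projection of a cochain to its part of parity `r`. -/
def parityPart (r : Fin 2) : Cochain k A B →ₗ[k] Cochain k A B :=
  (2⁻¹ : k) • (LinearMap.id + sgn k ((r : ℕ) : ℤ) • tau 𝒜 ℬ 1)

/-- `h ∘ (ψ₁ ⊗ … ⊗ ψₛ)` with the Koszul signs: `ψⱼ` is moved past the arguments of `ψₗ`,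
for all `l < j`. -/
def signedComp (h : Cochain k B B) (s : ℕ) :
    MultilinearMap k (fun _ : Fin s => Cochain k A B) (Cochain k A B) :=
  ∑ r : Fin s → Fin 2, (plainComp h s).compLinearMap fun l =>
    signIn 𝒜 (∑ j ∈ Finset.Ioi l, ((r j : ℕ) : ℤ)) ∘ₗ parityPart 𝒜 ℬ (r l)

variable (k A B) in
/-- Let `Ψ = ∏_{m>0} Hom((sA)^{⊗ m}, sB)`. The cobar construction of the tensor coalgebra
`T^c(Ψ) = ⨁_{n>0} Ψ^{⊗ n}` is spanned by the words `s⁻¹(ψ₁,…,ψ_{c₁}) ⊗ … ⊗ s⁻¹(ψ_{cₚ₋₁₊₁},…,ψₙ)`,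
that is, by words of `n > 0` letters in `Ψ`, cut into `p` blocks. The places of the cuts are
recorded as a set `S ⊆ {1, …, n - 1}` with `p - 1` elements, where `c ∈ S` is the cut after the
first `c` letters.
A family `x` stands for the formal series of its components `x n S N`: a tensor with `n` letters,
cut at `S`, of total arity `N`. -/
abbrev CobarFamily : Type _ :=
  ∀ (n : ℕ) (_ : Finset ℕ) (_ : ℕ), ⨂[k]^n (Cochain k A B)

/-- The tensors with `n` letters, cut at `S`, of total arity `N`, and of degree `d` in the
cobar construction, where each of the `|S| + 1` desuspensions adds one to the degree. -/
def cobarPiece (n : ℕ) (S : Finset ℕ) (N : ℕ) (d : ℤ) : Submodule k (⨂[k]^n (Cochain k A B)) :=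
  if 0 < n ∧ S ⊆ Finset.Ioo 0 n then
    Submodule.span k {t | ∃ (e : Fin n → ℤ) (m : Fin n → ℕ) (ψ : Fin n → Cochain k A B),
      (∑ i, e i) + ((S.card : ℤ) + 1) = d ∧ ∑ i, m i = N ∧
      (∀ i, ψ i ∈ cochainDeg 𝒜 ℬ (e i) ∧ ∀ m', m' ≠ m i → ψ i m' = 0) ∧
      t = PiTensorProduct.tprod k ψ}
  else ⊥

/-- The elements of degree `d` of the completed cobar construction `⨁_{p>0} Γ̄ₚ` of `T^c(Ψ)`:
the number `p = |S| + 1` of blocks is bounded, and for each `p` all formal series with respect to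
the number of letters and to their arities are allowed. -/
def cobarDeg (d : ℤ) : Submodule k (CobarFamily k A B) where
  carrier := {x | (∀ n S N, x n S N ∈ cobarPiece 𝒜 ℬ n S N d) ∧
    ∃ P : ℕ, ∀ n S N, P < S.card + 1 → x n S N = 0}
  zero_mem' := ⟨fun _ _ _ => zero_mem _, 0, fun _ _ _ _ => rfl⟩
  add_mem' := by
    rintro x y ⟨hx, P, hP⟩ ⟨hy, Q, hQ⟩
    refine ⟨fun n S N => add_mem (hx n S N) (hy n S N), max P Q, fun n S N h => ?_⟩
    simp only [Pi.add_apply]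
    rw [hP n S N (lt_of_le_of_lt (le_max_left _ _) h),
      hQ n S N (lt_of_le_of_lt (le_max_right _ _) h), add_zero]
  smul_mem' := by
    rintro c x ⟨hx, P, hP⟩
    refine ⟨fun n S N => Submodule.smul_mem _ c (hx n S N), P, fun n S N h => ?_⟩
    simp only [Pi.smul_apply]
    rw [hP n S N h, smul_zero]

/-- The product of the cobar construction: words are concatenated, and a cut is put between
them. -/
def cobarMul (x y : CobarFamily k A B) : CobarFamily k A B := fun n S N =>
  ∑ c : Fin n, if 0 < (c : ℕ) ∧ (c : ℕ) ∈ S then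
    ∑ p ∈ Finset.HasAntidiagonal.antidiagonal N,
      TensorPower.cast k (Cochain k A B) (by have := c.2; omega : (c : ℕ) + (n - c) = n)
        (TensorPower.mulEquiv
          (x c (S.filter (· < (c : ℕ))) p.1 ⊗ₜ[k]
            y (n - c) ((S.filter ((c : ℕ) < ·)).image (· - (c : ℕ))) p.2))
  else 0

/-- The differential of the cobar construction: the derivation with
`δ (s⁻¹(ψ₁,…,ψₙ)) = ∑ (-1)^{ψ₁ + … + ψᵢ + 1} s⁻¹(ψ₁,…,ψᵢ) ⊗ s⁻¹(ψᵢ₊₁,…,ψₙ)`. -/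
def cobarDiff (x : CobarFamily k A B) : CobarFamily k A B := fun n S N =>
  ∑ c : Fin n, if 0 < (c : ℕ) ∧ (c : ℕ) ∈ S then
    sgn k (1 + ((S.filter (· < (c : ℕ))).card : ℤ)) •
      PiTensorProduct.map (fun j : Fin n => if j < c then tau 𝒜 ℬ 1 else LinearMap.id)
        (x n (S.erase c) N)
  else 0

/-- The left action of a cochain `h` of degree `d` on the cobar construction: the derivation
with `h · s⁻¹(ψ₁,…,ψₙ) = ∑ (-1)^{h (ψ₁ + … + ψᵢ)} s⁻¹(ψ₁,…, h ∘ (ψᵢ₊₁ ⊗ … ⊗ ψᵢ₊ₛ), …,ψₙ)`. -/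
def leftAction (d : ℤ) (h : Cochain k B B) (x : CobarFamily k A B) : CobarFamily k A B :=
  fun n S N => ∑ q ∈ Finset.range N, ∑ i : Fin n,
    sgn k (d * ((S.filter (· ≤ (i : ℕ))).card : ℤ)) •
      PiTensorProduct.lift
        (splice (by omega : n + (q + 1) = (n + q) + 1) i (tau 𝒜 ℬ d) (signedComp 𝒜 ℬ h (q + 1))
          (PiTensorProduct.tprod k))
        (x (n + q) (S.image fun c => if c ≤ (i : ℕ) then c else c + q) N)

/-- The right action of a cochain `g` of degree `d` on the cobar construction: the right derivation
with `s⁻¹(ψ₁,…,ψₙ) · g = (-1)^g ∑ (-1)^{g (ψᵢ₊₁ + … + ψₙ)} s⁻¹(ψ₁,…, ψᵢ ∘ ĝ, …,ψₙ)`. -/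
def rightAction (d : ℤ) (x : CobarFamily k A B) (g : Cochain k A A) : CobarFamily k A B :=
  fun n S N => ∑ q ∈ Finset.range N, ∑ i : Fin n,
    sgn k (d * (1 + ((S.filter ((i : ℕ) < ·)).card : ℤ))) •
      PiTensorProduct.map (fun j : Fin n =>
          if j < i then LinearMap.id
          else if i < j then tau 𝒜 ℬ d
          else brace 𝒜 d (Pi.single (q + 1) (g (q + 1))))
        (x n S (N - q))

/-! ### The dg Lie algebra `L(A,B)` -/

variable (k A B) in
/-- Triples of a cochain of `A`, a cochain of `B`, and a family of cobar words. -/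
abbrev Ambient : Type _ := Cochain k A A × Cochain k B B × CobarFamily k A B

/-- The elements of degree `d` of `L(A,B) = g ⊕ h ⊕ Γ̄`. -/
def lieDeg (d : ℤ) : Submodule k (Ambient k A B) :=
  (cochainDeg 𝒜 𝒜 d).prod ((cochainDeg ℬ ℬ d).prod (cobarDeg 𝒜 ℬ d))

/-- The operation `b₁,₁ (x, y)` of the `B_∞`-algebra, for `x` of degree `i` and `y` of degree `j`:
the pre-Lie products of `g` and `h`, the product of `Γ̄`, the left action of `h` on `Γ̄`, and the
right action of `g` on `Γ̄`. -/
def b11 (i j : ℤ) (x y : Ambient k A B) : Ambient k A B :=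
  (brace 𝒜 j y.1 x.1, brace ℬ j y.2.1 x.2.1,
    cobarMul x.2.2 y.2.2 + leftAction 𝒜 ℬ i x.2.1 y.2.2 + rightAction 𝒜 ℬ j x.2.2 y.1)

/-- The operation `d₁` of the `B_∞`-algebra: the differential of `Γ̄`, and zero on `g` and `h`. -/
def d1 (x : Ambient k A B) : Ambient k A B := (0, 0, cobarDiff 𝒜 ℬ x.2.2)


/-! ### The operations respect the degrees -/

theorem sum_spliceIndex {M : Type*} [AddCommMonoid M] {N n s : ℕ} (h : n + s = N + 1) (i : Fin n)
    (e : Fin N → M) :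
    ∑ j : Fin n, (if h1 : j < i then e ⟨j, by have := i.2; have : j.1 < i.1 := h1; omega⟩
      else if h2 : i < j then e ⟨j + s - 1, by have := j.2; have : i.1 < j.1 := h2; omega⟩
      else ∑ l : Fin s, e ⟨i + l, by have := i.2; have := l.2; omega⟩) = ∑ p, e p := by
  obtain ⟨i, hi⟩ := i
  obtain ⟨t, rfl⟩ : ∃ t, n = i + 1 + t := ⟨n - (i + 1), by omega⟩
  obtain rfl : N = i + s + t := by omega
  rw [Fin.sum_univ_add, Fin.sum_univ_castSucc, Fin.sum_univ_add (fun p : Fin (i + s + t) => e p),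
    Fin.sum_univ_add (fun p : Fin (i + s) => e (Fin.castAdd t p))]
  congr 1
  · congr 1
    · refine Finset.sum_congr rfl fun j _ => ?_
      have hj : (Fin.castAdd t j.castSucc : Fin (i + 1 + t)) < ⟨i, hi⟩ := by
        simp [Fin.lt_def]
      rw [dif_pos hj]
      rfl
    · rw [dif_neg (by simp [Fin.lt_def]), dif_neg (by simp [Fin.lt_def])]
      rfl
  · refine Finset.sum_congr rfl fun j _ => ?_
    rw [dif_neg (by simp [Fin.lt_def]; omega), dif_pos (by simp [Fin.lt_def]; omega)]
    congr 1
    apply Fin.ext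
    simp
    omega

theorem koszul_apply_of_mem {j e : ℤ} {a : A} (ha : a ∈ 𝒜 e) :
    koszul 𝒜 j a = sgn k (j * (e - 1)) • a := by
  simp only [koszul, LinearMap.comp_apply, LinearEquiv.coe_coe,
    DirectSum.decomposeLinearEquiv_apply]
  rw [DirectSum.decompose_of_mem 𝒜 ha]
  erw [DirectSum.toModule_lof]
  rfl

theorem koszul_mem {j e : ℤ} {a : A} (ha : a ∈ 𝒜 e) : koszul 𝒜 j a ∈ 𝒜 e := by
  rw [koszul_apply_of_mem 𝒜 ha]
  exact Submodule.smul_mem _ _ ha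

theorem brace_mem {i j : ℤ} {f : Cochain k A B} {α : Cochain k A A}
    (hf : f ∈ cochainDeg 𝒜 ℬ i) (hα : α ∈ cochainDeg 𝒜 𝒜 j) :
    brace 𝒜 j α f ∈ cochainDeg 𝒜 ℬ (i + j) := by
  refine ⟨rfl, fun N => ?_⟩
  refine Submodule.sum_mem (homDeg 𝒜 ℬ N (i + j)) fun q _ =>
    Submodule.sum_mem (homDeg 𝒜 ℬ N (i + j)) fun r _ => ?_
  intro e x hx
  have hN : N - q + (q + 1) = N + 1 := by have := q.2; omega
  let e' : Fin (N - q) → ℤ := fun l =>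
    (if h1 : l < r then e ⟨l, by have := r.2; have : l.1 < r.1 := h1; omega⟩
      else if h2 : r < l then e ⟨l + (q + 1) - 1, by have := l.2; have : r.1 < l.1 := h2; omega⟩
      else ∑ t : Fin (q + 1), e ⟨r + t, by have := r.2; have := t.2; omega⟩)
      + if l = r then j else 0
  have hsum : ∑ l, e' l = ∑ p, e p + j := by
    simp only [e', Finset.sum_add_distrib]
    rw [sum_spliceIndex hN r e]
    simp
  have := hf.2 (N - q) e' (spliceWord hN r (koszul 𝒜 j) (α (q + 1)) x) ?_
  · rw [hsum] at this
    have h2 : ∑ p, e p + j + i + 1 = ∑ p, e p + (i + j) + 1 := by ring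
    rwa [h2] at this
  · intro l
    simp only [e', spliceWord]
    split_ifs with h1 h2 h3 h4 h5
    · exact absurd h1 (by simp [h2])
    · rw [add_zero]; exact koszul_mem 𝒜 (hx _)
    · exact absurd h3 (by simp [h4])
    · rw [add_zero]; exact hx _
    · exact hα.2 (q + 1) _ _ fun t => hx _
    · exact absurd (le_antisymm (not_lt.1 h3) (not_lt.1 h1)) h5

theorem tau_mem (j : ℤ) {d : ℤ} {f : Cochain k A B} (hf : f ∈ cochainDeg 𝒜 ℬ d) :
    tau 𝒜 ℬ j f ∈ cochainDeg 𝒜 ℬ d := by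
  refine ⟨?_, fun m e x hx => ?_⟩
  · change (koszul ℬ j).compMultilinearMap ((f 0).compLinearMap fun _ => koszul 𝒜 j) = 0
    rw [hf.1]
    ext x
    simp
  · exact koszul_mem ℬ (hf.2 m e _ fun i => koszul_mem 𝒜 (hx i))

theorem tau_apply_eq_zero (j : ℤ) {m : ℕ} {f : Cochain k A B} (hf : f m = 0) :
    tau 𝒜 ℬ j f m = 0 := by
  change (koszul ℬ j).compMultilinearMap ((f m).compLinearMap fun _ => koszul 𝒜 j) = 0
  rw [hf]
  ext x
  simp

theorem signIn_mem (j : ℤ) {d : ℤ} {f : Cochain k A B} (hf : f ∈ cochainDeg 𝒜 ℬ d) :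
    signIn 𝒜 j f ∈ cochainDeg 𝒜 ℬ d := by
  refine ⟨?_, fun m e x hx => ?_⟩
  · change (f 0).compLinearMap (fun _ => koszul 𝒜 j) = 0
    rw [hf.1]
    ext x
    simp
  · exact hf.2 m e _ fun i => koszul_mem 𝒜 (hx i)

theorem signIn_apply_eq_zero (j : ℤ) {m : ℕ} {f : Cochain k A B} (hf : f m = 0) :
    signIn 𝒜 j f m = 0 := by
  change (f m).compLinearMap (fun _ => koszul 𝒜 j) = 0
  rw [hf]
  ext x
  simp

theorem parityPart_mem (r : Fin 2) {d : ℤ} {f : Cochain k A B} (hf : f ∈ cochainDeg 𝒜 ℬ d) :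
    parityPart 𝒜 ℬ r f ∈ cochainDeg 𝒜 ℬ d := by
  refine Submodule.smul_mem (cochainDeg 𝒜 ℬ d) _ (add_mem hf ?_)
  exact Submodule.smul_mem (cochainDeg 𝒜 ℬ d) _ (tau_mem 𝒜 ℬ 1 hf)

theorem parityPart_apply_eq_zero (r : Fin 2) {m : ℕ} {f : Cochain k A B} (hf : f m = 0) :
    parityPart 𝒜 ℬ r f m = 0 := by
  change (2⁻¹ : k) • (f m + sgn k ((r : ℕ) : ℤ) • tau 𝒜 ℬ 1 f m) = 0
  rw [hf, tau_apply_eq_zero 𝒜 ℬ 1 hf]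
  simp

theorem plainComp_mem {d : ℤ} {h : Cochain k B B} (hh : h ∈ cochainDeg ℬ ℬ d) {s : ℕ}
    {e : Fin s → ℤ} {ψ : Fin s → Cochain k A B} (hψ : ∀ l, ψ l ∈ cochainDeg 𝒜 ℬ (e l)) :
    plainComp h s ψ ∈ cochainDeg 𝒜 ℬ (∑ l, e l + d) := by
  refine ⟨?_, fun N => ?_⟩
  · change (∑ c : {c : Composition 0 // c.length = s},
      blockComp c.1 (h c.1.length) fun j => ψ (Fin.cast c.2 j) (c.1.blocksFun j)) = 0
    refine Finset.sum_eq_zero fun c _ => ?_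
    have hc : c.1.length = 0 := Nat.le_zero.1 c.1.length_le
    have h0 : ∀ l, l = 0 → h l = 0 := by rintro l rfl; exact hh.1
    ext x
    change h c.1.length _ = 0
    rw [h0 _ hc]
    rfl
  · refine Submodule.sum_mem (homDeg 𝒜 ℬ N (∑ l, e l + d)) fun c _ => ?_
    obtain ⟨c, rfl⟩ := c
    intro a x hx
    have := hh.2 c.length (fun j => ∑ t, a (c.embedding j t) + e j)
      (fun j => ψ j (c.blocksFun j) (x ∘ c.embedding j))
      (fun j => (hψ j).2 _ (fun t => a (c.embedding j t)) _ fun t => hx _)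
    rw [Finset.sum_add_distrib] at this
    have hs : ∑ j, ∑ t, a (c.embedding j t) = ∑ p, a p := by
      rw [Finset.sum_sigma', Finset.univ_sigma_univ]
      exact c.blocksFinEquiv.sum_comp a
    rw [hs] at this
    have h2 : ∑ p, a p + ∑ l, e l + d + 1 = ∑ p, a p + (∑ l, e l + d) + 1 := by ring
    rw [h2] at this
    exact this

theorem plainComp_apply_eq_zero (h : Cochain k B B) {s : ℕ} {m : Fin s → ℕ}
    {ψ : Fin s → Cochain k A B} (hψ : ∀ l m', m' ≠ m l → ψ l m' = 0) {N : ℕ}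
    (hN : N ≠ ∑ l, m l) : plainComp h s ψ N = 0 := by
  change (∑ c : {c : Composition N // c.length = s},
    blockComp c.1 (h c.1.length) fun j => ψ (Fin.cast c.2 j) (c.1.blocksFun j)) = 0
  refine Finset.sum_eq_zero fun c _ => ?_
  obtain ⟨c, rfl⟩ := c
  have : ∃ j, c.blocksFun j ≠ m j := by
    by_contra hcon
    push Not at hcon
    apply hN
    exact c.sum_blocksFun.symm.trans (Finset.sum_congr rfl fun j _ => hcon j)
  obtain ⟨j, hj⟩ := this
  ext x
  refine (h c.length).map_coord_zero j ?_
  change ψ j (c.blocksFun j) _ = 0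
  rw [hψ j _ hj]
  rfl

theorem signedComp_apply (h : Cochain k B B) (s : ℕ) (ψ : Fin s → Cochain k A B) :
    signedComp 𝒜 ℬ h s ψ = ∑ r : Fin s → Fin 2, plainComp h s fun l =>
      signIn 𝒜 (∑ j ∈ Finset.Ioi l, ((r j : ℕ) : ℤ)) (parityPart 𝒜 ℬ (r l) (ψ l)) := by
  rw [signedComp, sum_apply]
  rfl

theorem signedComp_mem {d : ℤ} {h : Cochain k B B} (hh : h ∈ cochainDeg ℬ ℬ d) {s : ℕ}
    {e : Fin s → ℤ} {ψ : Fin s → Cochain k A B} (hψ : ∀ l, ψ l ∈ cochainDeg 𝒜 ℬ (e l)) :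
    signedComp 𝒜 ℬ h s ψ ∈ cochainDeg 𝒜 ℬ (∑ l, e l + d) := by
  rw [signedComp_apply]
  refine Submodule.sum_mem (cochainDeg 𝒜 ℬ (∑ l, e l + d)) fun r _ => ?_
  exact plainComp_mem 𝒜 ℬ hh fun l => signIn_mem 𝒜 ℬ _ (parityPart_mem 𝒜 ℬ _ (hψ l))

theorem signedComp_apply_eq_zero (h : Cochain k B B) {s : ℕ} {m : Fin s → ℕ}
    {ψ : Fin s → Cochain k A B} (hψ : ∀ l m', m' ≠ m l → ψ l m' = 0) {N : ℕ}
    (hN : N ≠ ∑ l, m l) : signedComp 𝒜 ℬ h s ψ N = 0 := by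
  rw [signedComp_apply, Finset.sum_apply]
  refine Finset.sum_eq_zero fun r _ => ?_
  exact plainComp_apply_eq_zero h (m := m) (fun l m' hm' =>
    signIn_apply_eq_zero 𝒜 _ (parityPart_apply_eq_zero 𝒜 ℬ _ (hψ l m' hm'))) hN

theorem single_mem {d : ℤ} {g : Cochain k A A} (hg : g ∈ cochainDeg 𝒜 𝒜 d) (q : ℕ) :
    (Pi.single (q + 1) (g (q + 1)) : Cochain k A A) ∈ cochainDeg 𝒜 𝒜 d := by
  refine ⟨Pi.single_eq_of_ne (by omega) _, fun m => ?_⟩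
  by_cases hm : m = q + 1
  · subst hm
    rw [Pi.single_eq_same]
    exact hg.2 _
  · rw [Pi.single_eq_of_ne hm]
    exact zero_mem _

theorem brace_single_apply_eq_zero (d : ℤ) (g : Cochain k A A) (q : ℕ) {m : ℕ}
    {ψ : Cochain k A B} (hψ : ∀ m', m' ≠ m → ψ m' = 0) {N : ℕ} (hN : N ≠ m + q) :
    brace 𝒜 d (Pi.single (q + 1) (g (q + 1))) ψ N = 0 := by
  change (∑ t : Fin N, ∑ r : Fin (N - t), splice (by have := t.2; omega : N - t + (t + 1) = N + 1) r
    (koszul 𝒜 d) ((Pi.single (q + 1) (g (q + 1)) : Cochain k A A) (t + 1)) (ψ (N - t))) = 0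
  refine Finset.sum_eq_zero fun t _ => Finset.sum_eq_zero fun r _ => ?_
  ext x
  by_cases ht : t.1 = q
  · have : N - t ≠ m := by have := t.2; omega
    change ψ (N - t) _ = 0
    rw [hψ _ this]
    rfl
  · refine (ψ (N - t)).map_coord_zero r ?_
    simp only [spliceWord, lt_self_iff_false, dite_false]
    rw [Pi.single_eq_of_ne (by omega)]
    rfl

theorem tprod_mem_cobarPiece {n : ℕ} {S : Finset ℕ} {N : ℕ} {d : ℤ} (hn : 0 < n)
    (hS : S ⊆ Finset.Ioo 0 n) (e : Fin n → ℤ) (m : Fin n → ℕ) {ψ : Fin n → Cochain k A B}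
    (he : (∑ i, e i) + ((S.card : ℤ) + 1) = d) (hm : ∑ i, m i = N)
    (hψ : ∀ i, ψ i ∈ cochainDeg 𝒜 ℬ (e i) ∧ ∀ m', m' ≠ m i → ψ i m' = 0) :
    PiTensorProduct.tprod k ψ ∈ cobarPiece 𝒜 ℬ n S N d := by
  rw [cobarPiece, if_pos ⟨hn, hS⟩]
  exact Submodule.subset_span ⟨e, m, ψ, he, hm, hψ, rfl⟩

theorem map_mem_of_mem_cobarPiece {n : ℕ} {S : Finset ℕ} {N : ℕ} {d : ℤ}
    {M : Type*} [AddCommGroup M] [Module k M] (p : Submodule k M)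
    (Φ : (⨂[k]^n (Cochain k A B)) →ₗ[k] M)
    (hΦ : 0 < n → S ⊆ Finset.Ioo 0 n → ∀ (e : Fin n → ℤ) (m : Fin n → ℕ)
      (ψ : Fin n → Cochain k A B), (∑ i, e i) + ((S.card : ℤ) + 1) = d → ∑ i, m i = N →
      (∀ i, ψ i ∈ cochainDeg 𝒜 ℬ (e i) ∧ ∀ m', m' ≠ m i → ψ i m' = 0) →
      Φ (PiTensorProduct.tprod k ψ) ∈ p)
    {t : ⨂[k]^n (Cochain k A B)} (ht : t ∈ cobarPiece 𝒜 ℬ n S N d) : Φ t ∈ p := by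
  by_cases hv : 0 < n ∧ S ⊆ Finset.Ioo 0 n
  · rw [cobarPiece, if_pos hv] at ht
    refine Submodule.span_induction (p := fun t _ => Φ t ∈ p) ?_ ?_ ?_ ?_ ht
    · rintro _ ⟨e, m, ψ, he, hm, hψ, rfl⟩
      exact hΦ hv.1 hv.2 e m ψ he hm hψ
    · rw [map_zero]; exact zero_mem _
    · intro a b _ _ ha hb
      rw [map_add]; exact add_mem ha hb
    · intro c a _ ha
      rw [map_smul]; exact Submodule.smul_mem _ c ha
  · rw [cobarPiece, if_neg hv, Submodule.mem_bot] at ht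
    rw [ht, map_zero]
    exact zero_mem _

theorem cobarDiff_mem {d : ℤ} {x : CobarFamily k A B} (hx : x ∈ cobarDeg 𝒜 ℬ d) :
    cobarDiff 𝒜 ℬ x ∈ cobarDeg 𝒜 ℬ (d + 1) := by
  obtain ⟨hx, P, hP⟩ := hx
  refine ⟨fun n S N => ?_, P + 1, fun n S N h => ?_⟩
  · refine Submodule.sum_mem _ fun c _ => ?_
    split_ifs with hc
    · refine Submodule.smul_mem _ _ ?_
      refine map_mem_of_mem_cobarPiece 𝒜 ℬ _ _ (fun hn hS e m ψ he hm hψ => ?_) (hx n (S.erase c) N)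
      rw [PiTensorProduct.map_tprod]
      have hcard := Finset.card_erase_add_one hc.2
      refine tprod_mem_cobarPiece 𝒜 ℬ hn ?_ e m ?_ hm fun i => ?_
      · intro a ha
        by_cases hac : a = c
        · subst hac
          exact Finset.mem_Ioo.2 ⟨hc.1, c.2⟩
        · exact hS (Finset.mem_erase.2 ⟨hac, ha⟩)
      · rw [← hcard, ← he]
        push_cast
        ring
      · split_ifs
        · exact ⟨tau_mem 𝒜 ℬ 1 (hψ i).1, fun m' hm' =>
            tau_apply_eq_zero 𝒜 ℬ 1 ((hψ i).2 m' hm')⟩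
        · exact hψ i
    · exact zero_mem _
  · refine Finset.sum_eq_zero fun c _ => ?_
    split_ifs with hc
    · have hcard := Finset.card_erase_add_one hc.2
      rw [hP n (S.erase c) N (by omega), map_zero, smul_zero]
    · rfl

theorem rightAction_mem {d j : ℤ} {x : CobarFamily k A B} {g : Cochain k A A}
    (hx : x ∈ cobarDeg 𝒜 ℬ d) (hg : g ∈ cochainDeg 𝒜 𝒜 j) :
    rightAction 𝒜 ℬ j x g ∈ cobarDeg 𝒜 ℬ (d + j) := by
  obtain ⟨hx, P, hP⟩ := hx
  refine ⟨fun n S N => ?_, P, fun n S N h => ?_⟩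
  · refine Submodule.sum_mem _ fun q hq => Submodule.sum_mem _ fun i _ => ?_
    refine Submodule.smul_mem _ _ ?_
    have hq' := Finset.mem_range.1 hq
    refine map_mem_of_mem_cobarPiece 𝒜 ℬ _ _ (fun hn hS e m ψ he hm hψ => ?_) (hx n S (N - q))
    rw [PiTensorProduct.map_tprod]
    refine tprod_mem_cobarPiece 𝒜 ℬ hn hS (fun l => e l + if l = i then j else 0)
      (fun l => m l + if l = i then q else 0) ?_ ?_ fun l => ?_
    · rw [Finset.sum_add_distrib, ← he]
      simp only [Finset.sum_ite_eq', Finset.mem_univ, if_true]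
      ring
    · rw [Finset.sum_add_distrib, hm]
      simp only [Finset.sum_ite_eq', Finset.mem_univ, if_true]
      omega
    · rcases lt_trichotomy l i with hl | hl | hl
      · simp only [if_pos hl, if_neg hl.ne, add_zero]
        exact hψ l
      · subst hl
        simp only [lt_self_iff_false, if_false, if_true]
        exact ⟨brace_mem 𝒜 ℬ (hψ l).1 (single_mem 𝒜 hg q), fun m' hm' =>
          brace_single_apply_eq_zero 𝒜 j g q (hψ l).2 hm'⟩
      · simp only [if_pos hl, if_neg hl.not_gt, if_neg hl.ne', add_zero]
        exact ⟨tau_mem 𝒜 ℬ j (hψ l).1, fun m' hm' =>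
          tau_apply_eq_zero 𝒜 ℬ j ((hψ l).2 m' hm')⟩
  · refine Finset.sum_eq_zero fun q _ => Finset.sum_eq_zero fun i _ => ?_
    rw [hP n S _ h, map_zero, smul_zero]

theorem leftAction_mem {d j : ℤ} {x : CobarFamily k A B} {h : Cochain k B B}
    (hh : h ∈ cochainDeg ℬ ℬ d) (hx : x ∈ cobarDeg 𝒜 ℬ j) :
    leftAction 𝒜 ℬ d h x ∈ cobarDeg 𝒜 ℬ (d + j) := by
  obtain ⟨hx, P, hP⟩ := hx
  have hinj : ∀ (i q : ℕ), Function.Injective fun c : ℕ => if c ≤ i then c else c + q := by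
    intro i q a b hab
    simp only at hab
    split_ifs at hab <;> omega
  refine ⟨fun n S N => ?_, P, fun n S N hPS => ?_⟩
  · refine Submodule.sum_mem _ fun q hq => Submodule.sum_mem _ fun i _ => ?_
    refine Submodule.smul_mem _ _ ?_
    refine map_mem_of_mem_cobarPiece 𝒜 ℬ _ _ (fun hn hS e m ψ he hm hψ => ?_)
      (hx (n + q) (S.image fun c => if c ≤ (i : ℕ) then c else c + q) N)
    rw [PiTensorProduct.lift.tprod]
    rw [Finset.card_image_of_injective _ (hinj _ _)] at he
    have hN : n + (q + 1) = (n + q) + 1 := by omega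
    let e' : Fin n → ℤ := fun l =>
      (if h1 : l < i then e ⟨l, by have := i.2; have : l.1 < i.1 := h1; omega⟩
        else if h2 : i < l then e ⟨l + (q + 1) - 1, by have := l.2; have : i.1 < l.1 := h2; omega⟩
        else ∑ t : Fin (q + 1), e ⟨i + t, by have := i.2; have := t.2; omega⟩)
        + if l = i then d else 0
    let m' : Fin n → ℕ := fun l =>
      (if h1 : l < i then m ⟨l, by have := i.2; have : l.1 < i.1 := h1; omega⟩
        else if h2 : i < l then m ⟨l + (q + 1) - 1, by have := l.2; have : i.1 < l.1 := h2; omega⟩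
        else ∑ t : Fin (q + 1), m ⟨i + t, by have := i.2; have := t.2; omega⟩)
    refine tprod_mem_cobarPiece 𝒜 ℬ (ψ := spliceWord hN i (tau 𝒜 ℬ d)
      (signedComp 𝒜 ℬ h (q + 1)) ψ) (by have := i.2; omega) ?_ e' m' ?_ ?_ fun l => ?_
    · intro c hc
      have := Finset.mem_Ioo.1 (hS (Finset.mem_image_of_mem _ hc))
      have hi := i.2
      rw [Finset.mem_Ioo]
      split_ifs at this <;> omega
    · simp only [e', Finset.sum_add_distrib]
      rw [sum_spliceIndex hN i e, ← he]
      simp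
      ring
    · exact (sum_spliceIndex hN i m).trans hm
    · simp only [e', m', spliceWord]
      split_ifs with h1 h2 h3 h4 h5
      · exact absurd h1 (by simp [h2])
      · rw [add_zero]
        exact ⟨tau_mem 𝒜 ℬ d (hψ _).1, fun m' hm' =>
          tau_apply_eq_zero 𝒜 ℬ d ((hψ _).2 m' hm')⟩
      · exact absurd h3 (by simp [h4])
      · rw [add_zero]; exact hψ _
      · exact ⟨signedComp_mem 𝒜 ℬ hh fun t => (hψ _).1, fun m' hm' =>
          signedComp_apply_eq_zero 𝒜 ℬ h (fun t => (hψ _).2) hm'⟩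
      · exact absurd (le_antisymm (not_lt.1 h3) (not_lt.1 h1)) h5
  · refine Finset.sum_eq_zero fun q _ => Finset.sum_eq_zero fun i _ => ?_
    rw [hP, map_zero, smul_zero]
    rwa [Finset.card_image_of_injective _ (hinj _ _)]

theorem cobarMul_mem {i j : ℤ} {x y : CobarFamily k A B}
    (hx : x ∈ cobarDeg 𝒜 ℬ i) (hy : y ∈ cobarDeg 𝒜 ℬ j) :
    cobarMul x y ∈ cobarDeg 𝒜 ℬ (i + j) := by
  obtain ⟨hx, P, hP⟩ := hx
  obtain ⟨hy, Q, hQ⟩ := hy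
  have hinj : ∀ (S : Finset ℕ) (c : ℕ), Set.InjOn (fun a : ℕ => a - c) (S.filter (c < ·)) := by
    intro S c a ha b hb hab
    have ha' := (Finset.mem_filter.1 (Finset.mem_coe.1 ha)).2
    have hb' := (Finset.mem_filter.1 (Finset.mem_coe.1 hb)).2
    simp only at hab
    omega
  have hcard : ∀ (S : Finset ℕ) (c : ℕ), c ∈ S →
      S.card = (S.filter (· < c)).card + ((S.filter (c < ·)).image (· - c)).card + 1 := by
    intro S c hc
    rw [Finset.card_image_of_injOn (hinj S c)]
    have h1 : S = insert c (S.filter (· < c) ∪ S.filter (c < ·)) := by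
      ext a
      simp only [Finset.mem_insert, Finset.mem_union, Finset.mem_filter]
      constructor
      · intro ha
        rcases lt_trichotomy a c with h | h | h
        · exact Or.inr (Or.inl ⟨ha, h⟩)
        · exact Or.inl h
        · exact Or.inr (Or.inr ⟨ha, h⟩)
      · rintro (h | h | h)
        · exact h ▸ hc
        · exact h.1
        · exact h.1
    conv_lhs => rw [h1]
    rw [Finset.card_insert_of_notMem (by simp), Finset.card_union_of_disjoint]
    rw [Finset.disjoint_left]
    intro a ha hb
    have := (Finset.mem_filter.1 ha).2
    have := (Finset.mem_filter.1 hb).2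
    omega
  refine ⟨fun n S N => ?_, P + Q, fun n S N h => ?_⟩
  · refine Submodule.sum_mem _ fun c _ => ?_
    split_ifs with hc
    swap
    · exact zero_mem _
    refine Submodule.sum_mem _ fun p hp => ?_
    have hpN := Finset.HasAntidiagonal.mem_antidiagonal.1 hp
    have hcn : (c : ℕ) + (n - c) = n := by have := c.2; omega
    refine map_mem_of_mem_cobarPiece 𝒜 ℬ _
      ((TensorPower.cast k (Cochain k A B) hcn).toLinearMap ∘ₗ
        TensorPower.mulEquiv.toLinearMap ∘ₗ (TensorProduct.mk k _ _).flip
          (y (n - c) ((S.filter ((c : ℕ) < ·)).image (· - (c : ℕ))) p.2))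
      (fun hn hS e m ψ he hm hψ => ?_) (hx c (S.filter (· < (c : ℕ))) p.1)
    refine map_mem_of_mem_cobarPiece 𝒜 ℬ _
      ((TensorPower.cast k (Cochain k A B) hcn).toLinearMap ∘ₗ
        TensorPower.mulEquiv.toLinearMap ∘ₗ (TensorProduct.mk k _ _
          (PiTensorProduct.tprod k ψ)))
      (fun hn' hS' e' m' ψ' he' hm' hψ' => ?_)
      (hy (n - c) ((S.filter ((c : ℕ) < ·)).image (· - (c : ℕ))) p.2)
    have hval : (TensorPower.cast k (Cochain k A B) hcn) (TensorPower.mulEquiv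
        ((PiTensorProduct.tprod k ψ) ⊗ₜ[k] (PiTensorProduct.tprod k ψ')))
        = PiTensorProduct.tprod k (Fin.append ψ ψ' ∘ Fin.cast hcn.symm) := by
      rw [← TensorPower.gMul_def, TensorPower.tprod_mul_tprod, TensorPower.cast_tprod]
    change (TensorPower.cast k (Cochain k A B) hcn) (TensorPower.mulEquiv
        ((PiTensorProduct.tprod k ψ) ⊗ₜ[k] (PiTensorProduct.tprod k ψ'))) ∈ _
    rw [hval]
    have hsum : ∀ {M : Type} [AddCommMonoid M] (a : Fin c → M) (b : Fin (n - c) → M),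
        ∑ l, (Fin.append a b ∘ Fin.cast hcn.symm) l = ∑ l, a l + ∑ l, b l := by
      intro M _ a b
      rw [show ∑ l, (Fin.append a b ∘ Fin.cast hcn.symm) l = ∑ l, Fin.append a b l from
        (finCongr hcn.symm).sum_comp (Fin.append a b), Fin.sum_univ_add]
      simp only [Fin.append_left, Fin.append_right]
    refine tprod_mem_cobarPiece 𝒜 ℬ (by have := c.2; omega) ?_
      (Fin.append e e' ∘ Fin.cast hcn.symm) (Fin.append m m' ∘ Fin.cast hcn.symm) ?_ ?_ ?_
    · intro a ha
      rw [Finset.mem_Ioo]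
      have hc2 := c.2
      rcases lt_trichotomy a (c : ℕ) with h | h | h
      · have := Finset.mem_Ioo.1 (hS (Finset.mem_filter.2 ⟨ha, h⟩))
        omega
      · omega
      · have := Finset.mem_Ioo.1 (hS' (Finset.mem_image_of_mem _ (Finset.mem_filter.2 ⟨ha, h⟩)))
        omega
    · rw [hsum, ← he, ← he', hcard S c hc.2]
      push_cast
      ring
    · rw [hsum, hm, hm', hpN]
    · intro l
      simp only [Function.comp_apply]
      generalize Fin.cast hcn.symm l = l'
      induction l' using Fin.addCases with
      | left l' => simpa only [Fin.append_left] using hψ l'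
      | right l' => simpa only [Fin.append_right] using hψ' l'
  · refine Finset.sum_eq_zero fun c _ => ?_
    split_ifs with hc
    swap
    · rfl
    refine Finset.sum_eq_zero fun p hp => ?_
    have hcS := hcard S c hc.2
    rcases lt_or_ge P ((S.filter (· < (c : ℕ))).card + 1) with h1 | h1
    · rw [hP _ _ _ h1, TensorProduct.zero_tmul, map_zero, map_zero]
    · rw [hQ _ _ _ (by omega), TensorProduct.tmul_zero, map_zero, map_zero]

theorem d1_mem {d : ℤ} {x : Ambient k A B} (hx : x ∈ lieDeg 𝒜 ℬ d) :
    d1 𝒜 ℬ x ∈ lieDeg 𝒜 ℬ (d + 1) :=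
  ⟨zero_mem _, zero_mem _, cobarDiff_mem 𝒜 ℬ hx.2.2⟩

theorem b11_mem {i j : ℤ} {x y : Ambient k A B} (hx : x ∈ lieDeg 𝒜 ℬ i)
    (hy : y ∈ lieDeg 𝒜 ℬ j) : b11 𝒜 ℬ i j x y ∈ lieDeg 𝒜 ℬ (i + j) :=
  ⟨brace_mem 𝒜 𝒜 hx.1 hy.1, brace_mem ℬ ℬ hx.2.1 hy.2.1,
    add_mem (add_mem (cobarMul_mem 𝒜 ℬ hx.2.2 hy.2.2) (leftAction_mem 𝒜 ℬ hx.2.1 hy.2.2))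
      (rightAction_mem 𝒜 ℬ hx.2.2 hy.1)⟩

/-- The homogeneous component of degree `d` of `L(A,B)`. -/
abbrev L (d : ℤ) : Type _ := lieDeg 𝒜 ℬ d

/-- The differential of `L(A,B)`. -/
def differential {i : ℤ} (x : L 𝒜 ℬ i) : L 𝒜 ℬ (i + 1) :=
  ⟨d1 𝒜 ℬ x.1, d1_mem 𝒜 ℬ x.2⟩

/-- The bracket of `L(A,B)`: `[x, y] = b₁,₁ (x, y) + (-1)^(x y + 1) b₁,₁ (y, x)`. -/
def bracket {i j : ℤ} (x : L 𝒜 ℬ i) (y : L 𝒜 ℬ j) : L 𝒜 ℬ (i + j) :=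
  ⟨b11 𝒜 ℬ i j x.1 y.1 + sgn k (i * j + 1) • b11 𝒜 ℬ j i y.1 x.1,
    add_mem (b11_mem 𝒜 ℬ x.2 y.2)
      (Submodule.smul_mem _ _ (add_comm j i ▸ b11_mem 𝒜 ℬ y.2 x.2))⟩

/-- The solutions of the Maurer–Cartan equation: the elements `l` of degree one with
`d l + (1/2) [l, l] = 0`. -/
def maurerCartanSet : Set (L 𝒜 ℬ 1) :=
  {l | differential 𝒜 ℬ l + (2⁻¹ : k) • bracket 𝒜 ℬ l l = 0}

/-- The formal series `∑_{n>0} s⁻¹(ψ^{⊗ n})`. -/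
def geometricSeries (ψ : Cochain k A B) : CobarFamily k A B := fun n S N =>
  if 0 < n ∧ S = ∅ then
    ∑ m ∈ Finset.Nat.antidiagonalTuple n N,
      PiTensorProduct.tprod k fun i : Fin n => (Pi.single (m i) (ψ (m i)) : Cochain k A B)
  else 0

theorem geometricSeries_mem {ψ : Cochain k A B} (hψ : ψ ∈ cochainDeg 𝒜 ℬ 0) :
    geometricSeries ψ ∈ cobarDeg 𝒜 ℬ 1 := by
  refine ⟨fun n S N => ?_, 1, fun n S N h => ?_⟩
  · unfold geometricSeries
    split_ifs with hv
    · obtain ⟨hn, rfl⟩ := hv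
      refine Submodule.sum_mem _ fun m hm => ?_
      refine tprod_mem_cobarPiece 𝒜 ℬ hn (Finset.empty_subset _) (fun _ => 0) m (by simp)
        (Finset.Nat.mem_antidiagonalTuple.1 hm) fun i => ⟨⟨?_, fun m' => ?_⟩, fun m' hm' => ?_⟩
      · by_cases h0 : (0 : ℕ) = m i
        · rw [← h0, Pi.single_eq_same]
          exact hψ.1
        · exact Pi.single_eq_of_ne h0 _
      · by_cases h0 : m' = m i
        · subst h0
          rw [Pi.single_eq_same]
          exact hψ.2 _
        · rw [Pi.single_eq_of_ne h0]
          exact zero_mem _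
      · exact Pi.single_eq_of_ne hm' _
    · exact zero_mem _
  · refine if_neg fun hv => ?_
    rw [hv.2, Finset.card_empty] at h
    omega

/-- The element `α + β + ∑_{n>0} s⁻¹(ψ^{⊗ n})` of degree one of `L(A,B)`. -/
def AInfTriple.toLie (t : AInfTriple 𝒜 ℬ) : L 𝒜 ℬ 1 :=
  ⟨(t.α, t.β, geometricSeries t.ψ), t.isAlgebra_α.1, t.isAlgebra_β.1,
    geometricSeries_mem 𝒜 ℬ t.isMorphism_ψ.1⟩

end Graded

end AInfMor

end

noncomputable section

namespace AInfMor

universe u v w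

section MaurerCartan

set_option linter.unusedSectionVars false

variable {k : Type u} [Field k]
variable {A : Type v} [AddCommGroup A] [Module k A]
variable {B : Type w} [AddCommGroup B] [Module k B]
variable (𝒜 : ℤ → Submodule k A) [DirectSum.Decomposition 𝒜]
variable (ℬ : ℤ → Submodule k B) [DirectSum.Decomposition ℬ]

/-! For `l = α + β + γ` of degree one the bracket `[l, l]` is twice `b11 l l`, so the Maurer–Cartan
equation says that `α ∘ α̂ = 0`, that `β ∘ β̂ = 0`, and that `δγ + γγ + β·γ + γ·α = 0` in the cobar
construction (`mem_maurerCartanSet_iff`). The last equation is analysed by counting blocks: `δ` adds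
one block, the product adds the numbers of blocks, and the two actions preserve them.

The number of blocks of `γ` is bounded. If the largest number `p` were greater than one, the part of
the equation with `2p` blocks would receive nothing but the square of the top part `γ_p`, because
`δ` would have to start from `2p - 1 > p` blocks. A tensor `x` with `x ⊗ x = 0` vanishes, so `γ_p =
0`. Hence `γ` has single blocks only (`eq_zero_of_cobarMul_self`, `apply_eq_zero_of_maurerCartan`).

For such `γ` the two-block part reads `δγ + γγ = 0`. Its component with `n + 1` letters and a cut
after the first one expresses the words of `n + 1` letters through those of one and of `n` letters.
So `γ` is determined by its one-letter words, which form a cochain `ψ` of degree zero; since `∑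
s⁻¹(ψ^{⊗ n})` solves the same equation, it equals `γ` (`eq_geometricSeries`).

What remains is the one-block part `β·γ + γ·α = 0`. On the geometric series its left side is the sum
of the words in `ψ` with one letter replaced by `β ∘ ψ̃ - ψ ∘ α̂` (`actions_geometricSeries`). It
vanishes if and only if this difference does, as the one-letter words show. Because `ψ` has degree
zero, no Koszul sign coming from its letters survives; the only signs left are those of the
desuspensions. -/

/-! ### Signs, and their disappearance on cochains of degree zero. -/

theorem sgn_zero : sgn k 0 = 1 := by simp [sgn]

theorem sgn_one : sgn k 1 = -1 := by simp [sgn]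

theorem sgn_mul_self (n : ℤ) : sgn k n * sgn k n = 1 := by
  rcases Int.even_or_odd n with h | h <;> simp [sgn, Int.negOnePow_even, Int.negOnePow_odd, h]

theorem sgn_add (m n : ℤ) : sgn k (m + n) = sgn k m * sgn k n := by
  simp [sgn, Int.negOnePow_add]

theorem sgn_sum {ι : Type*} (s : Finset ι) (e : ι → ℤ) :
    sgn k (∑ i ∈ s, e i) = ∏ i ∈ s, sgn k (e i) := by
  classical
  induction s using Finset.induction_on with
  | empty => simp [sgn_zero]
  | insert a s ha ih => rw [Finset.sum_insert ha, Finset.prod_insert ha, sgn_add, ih]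

theorem koszul_zero : koszul 𝒜 0 = LinearMap.id := by
  ext a
  induction a using DirectSum.Decomposition.inductionOn 𝒜 with
  | zero => simp
  | homogeneous a => simp [koszul_apply_of_mem 𝒜 a.2, sgn_zero]
  | add a b ha hb => rw [map_add, map_add, ha, hb]

theorem koszul_koszul (j : ℤ) (a : A) : koszul 𝒜 j (koszul 𝒜 j a) = a := by
  induction a using DirectSum.Decomposition.inductionOn 𝒜 with
  | zero => simp
  | homogeneous a =>
    rw [koszul_apply_of_mem 𝒜 a.2, map_smul, koszul_apply_of_mem 𝒜 a.2, smul_smul, sgn_mul_self,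
      one_smul]
  | add a b ha hb => rw [map_add, map_add, ha, hb]

theorem tau_tau (j : ℤ) (f : Cochain k A B) : tau 𝒜 ℬ j (tau 𝒜 ℬ j f) = f := by
  funext m
  ext x
  change koszul ℬ j (koszul ℬ j (f m fun i => koszul 𝒜 j (koszul 𝒜 j (x i)))) = f m x
  simp only [koszul_koszul]

theorem signIn_zero (f : Cochain k A B) : signIn 𝒜 0 f = f := by
  funext m
  ext x
  change f m (fun i => koszul 𝒜 0 (x i)) = f m x
  simp only [koszul_zero, LinearMap.id_apply]

/-- Multilinear maps that agree on homogeneous arguments are equal. -/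
theorem multilinear_ext_of_homogeneous {m : ℕ} {f g : MultilinearMap k (fun _ : Fin m => A) B}
    (h : ∀ (e : Fin m → ℤ) (x : Fin m → A), (∀ i, x i ∈ 𝒜 (e i)) → f x = g x) : f = g := by
  -- Bases of the homogeneous pieces, which exist over a field, unite to a basis of `A` consisting
  -- of homogeneous elements.
  let b := (DirectSum.Decomposition.isInternal 𝒜).collectedBasis
    fun i => Module.Free.chooseBasis k (𝒜 i)
  refine Module.Basis.ext_multilinear (fun _ => b) fun v => h (fun i => (v i).1) _ fun i => ?_
  exact DirectSum.IsInternal.collectedBasis_mem _ _ _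

/-- A map of degree zero has output degree equal to the sum of its input degrees, so the sign put on
the inputs and the sign put on the output are the same and cancel. -/
theorem tau_eq_self {j : ℤ} {f : Cochain k A B} (hf : f ∈ cochainDeg 𝒜 ℬ 0) :
    tau 𝒜 ℬ j f = f := by
  funext m
  refine multilinear_ext_of_homogeneous 𝒜 fun e x hx => ?_
  change koszul ℬ j (f m fun i => koszul 𝒜 j (x i)) = f m x
  -- The shift by one passes from degrees in `A` to degrees in `sA`.
  have h1 := hf.2 m (fun i => e i - 1) x (fun i => by simpa using hx i)
  have h2 : (fun i => koszul 𝒜 j (x i)) = fun i => sgn k (j * (e i - 1)) • x i := by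
    funext i
    rw [koszul_apply_of_mem 𝒜 (hx i)]
  rw [h2, MultilinearMap.map_smul_univ, map_smul, koszul_apply_of_mem ℬ h1, smul_smul, ← sgn_sum,
    ← Finset.mul_sum, add_zero, add_sub_cancel_right, sgn_mul_self, one_smul]

theorem single_apply_mem {d : ℤ} {ψ : Cochain k A B} (hψ : ψ ∈ cochainDeg 𝒜 ℬ d) (m : ℕ) :
    (Pi.single m (ψ m) : Cochain k A B) ∈ cochainDeg 𝒜 ℬ d := by
  rcases m with _ | q
  · rw [hψ.1, Pi.single_zero]
    exact zero_mem _
  · refine ⟨Pi.single_eq_of_ne (by omega) _, fun m => ?_⟩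
    by_cases hm : m = q + 1
    · subst hm
      rw [Pi.single_eq_same]
      exact hψ.2 _
    · rw [Pi.single_eq_of_ne hm]
      exact zero_mem _

/-- A cochain of degree zero is its own even part and has no odd part, so only the parity pattern `r
= 0` contributes, and there all the Koszul exponents are zero. The halves in `parityPart` add up to
one because `2` is invertible. -/
theorem signedComp_eq_plainComp [CharZero k] (h : Cochain k B B) {s : ℕ}
    {ψ : Fin s → Cochain k A B} (hψ : ∀ l, ψ l ∈ cochainDeg 𝒜 ℬ 0) :
    signedComp 𝒜 ℬ h s ψ = plainComp h s ψ := by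
  have hp0 : ∀ l, parityPart 𝒜 ℬ 0 (ψ l) = ψ l := fun l => by
    simp [parityPart, tau_eq_self 𝒜 ℬ (hψ l), sgn_zero, ← add_smul, ← two_mul]
  have hp1 : ∀ l, parityPart 𝒜 ℬ 1 (ψ l) = 0 := fun l => by
    simp [parityPart, tau_eq_self 𝒜 ℬ (hψ l), sgn_one]
  rw [signedComp_apply, Finset.sum_eq_single 0]
  · simp [signIn_zero, hp0]
  · intro r _ hr
    obtain ⟨l, hl⟩ : ∃ l, r l ≠ 0 := by
      by_contra hcon
      push Not at hcon
      exact hr (funext hcon)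
    refine (plainComp h s).map_coord_zero l ?_
    have hl1 : r l = 1 := by omega
    simp only [hl1, hp1, map_zero]
  · simp

/-! ### Words in the components of `ψ`, and the equation `δγ + γγ = 0`. -/

/-- The sum over all the tuples of arities of total `N` splits at any place. -/
theorem sum_antidiagonalTuple_add {M : Type*} [AddCommMonoid M] (a b N : ℕ)
    (f : (Fin (a + b) → ℕ) → M) :
    ∑ m ∈ Finset.Nat.antidiagonalTuple (a + b) N, f m
      = ∑ p ∈ Finset.HasAntidiagonal.antidiagonal N,
        ∑ u ∈ Finset.Nat.antidiagonalTuple a p.1, ∑ v ∈ Finset.Nat.antidiagonalTuple b p.2,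
          f (Fin.append u v) := by
  simp only [← Finset.sum_product']
  rw [Finset.sum_sigma']
  refine Finset.sum_bij'
    (fun m _ => ⟨(∑ i, m (Fin.castAdd b i), ∑ i, m (Fin.natAdd a i)),
      (fun i => m (Fin.castAdd b i), fun i => m (Fin.natAdd a i))⟩)
    (fun x _ => Fin.append x.2.1 x.2.2) ?_ ?_ ?_ ?_ ?_
  · intro m hm
    rw [Finset.Nat.mem_antidiagonalTuple, Fin.sum_univ_add] at hm
    simp [Finset.Nat.mem_antidiagonalTuple, hm]
  · rintro ⟨p, u, v⟩ hx
    simp only [Finset.mem_sigma, Finset.mem_product, Finset.Nat.mem_antidiagonalTuple,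
      Finset.HasAntidiagonal.mem_antidiagonal] at hx
    simp [Finset.Nat.mem_antidiagonalTuple, Fin.sum_univ_add, hx]
  · intro m _
    exact Fin.append_castAdd_natAdd
  · rintro ⟨⟨p, q⟩, u, v⟩ hx
    simp only [Finset.mem_sigma, Finset.mem_product, Finset.Nat.mem_antidiagonalTuple,
      Finset.HasAntidiagonal.mem_antidiagonal] at hx
    obtain ⟨-, rfl, rfl⟩ := hx
    simp
  · intro m _
    exact congrArg f (Fin.append_castAdd_natAdd).symm

/-- Applying `f ⊗ f` gives `f(x)² = 0` for every functional `f`, and functionals separate the points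
of a vector space. -/
theorem tmul_self_eq_zero {V : Type*} [AddCommGroup V] [Module k V] {x : V}
    (h : x ⊗ₜ[k] x = 0) : x = 0 := by
  rw [← Module.forall_dual_apply_eq_zero_iff k x]
  intro f
  have := congrArg ((TensorProduct.lid k k).toLinearMap ∘ₗ TensorProduct.map f f) h
  simpa using this

theorem tprod_mulEquiv_cast {V : Type*} [AddCommGroup V] [Module k V] {a b n : ℕ} (h : a + b = n)
    (u : Fin a → V) (v : Fin b → V) :
    TensorPower.cast k V h (TensorPower.mulEquiv
      (PiTensorProduct.tprod k u ⊗ₜ[k] PiTensorProduct.tprod k v))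
      = PiTensorProduct.tprod k (Fin.append u v ∘ Fin.cast h.symm) := by
  rw [← TensorPower.gMul_def, TensorPower.tprod_mul_tprod, TensorPower.cast_tprod]

/-- The word `ψ_{m₁}, …, ψ_{mₙ}` of the homogeneous components of `ψ` of arities `m₁, …, mₙ`. -/
def componentWord (ψ : Cochain k A B) {n : ℕ} (m : Fin n → ℕ) : Fin n → Cochain k A B :=
  fun i => Pi.single (m i) (ψ (m i))

theorem geometricSeries_empty (ψ : Cochain k A B) {n : ℕ} (hn : 0 < n) (N : ℕ) :
    geometricSeries ψ n ∅ N = ∑ m ∈ Finset.Nat.antidiagonalTuple n N,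
      PiTensorProduct.tprod k (componentWord ψ m) :=
  if_pos ⟨hn, rfl⟩

theorem geometricSeries_of_ne (ψ : Cochain k A B) (n : ℕ) {S : Finset ℕ} (hS : S ≠ ∅) (N : ℕ) :
    geometricSeries ψ n S N = 0 :=
  if_neg fun h => hS h.2

theorem componentWord_append (ψ : Cochain k A B) {a b : ℕ} (u : Fin a → ℕ) (v : Fin b → ℕ) :
    componentWord ψ (Fin.append u v) = Fin.append (componentWord ψ u) (componentWord ψ v) := by
  funext i
  induction i using Fin.addCases with
  | left i =>
    rw [Fin.append_left]
    exact congrArg (fun m => (Pi.single m (ψ m) : Cochain k A B)) (Fin.append_left u v i)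
  | right i =>
    rw [Fin.append_right]
    exact congrArg (fun m => (Pi.single m (ψ m) : Cochain k A B)) (Fin.append_right u v i)

/-- This is `ψ^{⊗ a} ⊗ ψ^{⊗ b} = ψ^{⊗ (a+b)}`, written in each total arity. -/
theorem sum_geometricSeries_mul (ψ : Cochain k A B) {a b n : ℕ} (h : a + b = n) (ha : 0 < a)
    (hb : 0 < b) (N : ℕ) :
    ∑ p ∈ Finset.HasAntidiagonal.antidiagonal N, TensorPower.cast k (Cochain k A B) h
      (TensorPower.mulEquiv (geometricSeries ψ a ∅ p.1 ⊗ₜ[k] geometricSeries ψ b ∅ p.2))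
      = geometricSeries ψ n ∅ N := by
  subst h
  rw [geometricSeries_empty ψ (by omega), sum_antidiagonalTuple_add]
  refine Finset.sum_congr rfl fun p _ => ?_
  rw [geometricSeries_empty ψ ha, geometricSeries_empty ψ hb, TensorProduct.sum_tmul, map_sum,
    map_sum]
  refine Finset.sum_congr rfl fun u _ => ?_
  rw [TensorProduct.tmul_sum, map_sum, map_sum]
  refine Finset.sum_congr rfl fun v _ => ?_
  rw [tprod_mulEquiv_cast, componentWord_append]
  rfl

theorem map_tau_geometricSeries {ψ : Cochain k A B} (hψ : ψ ∈ cochainDeg 𝒜 ℬ 0) {n : ℕ}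
    (j : ℤ) (p : Fin n → Prop) [DecidablePred p] (S : Finset ℕ) (N : ℕ) :
    PiTensorProduct.map (fun i => if p i then tau 𝒜 ℬ j else LinearMap.id)
      (geometricSeries ψ n S N) = geometricSeries ψ n S N := by
  unfold geometricSeries
  split_ifs
  · rw [map_sum]
    refine Finset.sum_congr rfl fun m _ => ?_
    rw [PiTensorProduct.map_tprod]
    congr 1
    funext i
    split_ifs
    · exact tau_eq_self 𝒜 ℬ (single_apply_mem 𝒜 ℬ hψ _)
    · rfl
  · exact map_zero _

theorem filter_lt_singleton (c : ℕ) : ({c} : Finset ℕ).filter (· < c) = ∅ := by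
  simp

theorem filter_gt_singleton (c : ℕ) : ({c} : Finset ℕ).filter (c < ·) = ∅ := by
  simp

/-- The geometric series solves the equation `δ γ + γ γ = 0`. -/
theorem cobarDiff_add_cobarMul_geometricSeries {ψ : Cochain k A B} (hψ : ψ ∈ cochainDeg 𝒜 ℬ 0) :
    cobarDiff 𝒜 ℬ (geometricSeries ψ) + cobarMul (geometricSeries ψ) (geometricSeries ψ) = 0 := by
  funext n S N
  simp only [Pi.add_apply, Pi.zero_apply, cobarDiff, cobarMul, ← Finset.sum_add_distrib]
  refine Finset.sum_eq_zero fun c _ => ?_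
  by_cases hc : 0 < (c : ℕ) ∧ (c : ℕ) ∈ S
  swap
  · rw [if_neg hc, if_neg hc, add_zero]
  rw [if_pos hc, if_pos hc, map_tau_geometricSeries 𝒜 ℬ hψ]
  -- The cancellation takes place for each cut `c` separately. When `c` is the only cut, `δ` and the
  -- product yield the same tensor, with the signs `-1` and `+1`.
  by_cases hS : S = {(c : ℕ)}
  · subst hS
    rw [filter_lt_singleton, filter_gt_singleton, Finset.image_empty,
      sum_geometricSeries_mul ψ _ hc.1 (by have := c.2; omega)]
    rw [Finset.card_empty, Nat.cast_zero, add_zero, sgn_one,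
      show ({(c : ℕ)} : Finset ℕ).erase c = ∅ by simp]
    exact (congrArg (· + _) (neg_one_smul k _)).trans (neg_add_cancel _)
  -- A second cut survives in `S.erase c`, and also in one of the two factors of the product, so
  -- both terms vanish.
  · have h1 : S.erase c ≠ ∅ := fun h => hS (by
      rw [← Finset.insert_erase hc.2, h]
      rfl)
    rw [geometricSeries_of_ne ψ n h1, smul_zero, zero_add]
    refine Finset.sum_eq_zero fun p _ => ?_
    by_cases h2 : S.filter (· < (c : ℕ)) = ∅
    · have h3 : (S.filter ((c : ℕ) < ·)).image (· - (c : ℕ)) ≠ ∅ := by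
        intro h3
        rw [Finset.image_eq_empty] at h3
        refine hS (Finset.eq_singleton_iff_unique_mem.2 ⟨hc.2, fun x hx => ?_⟩)
        rcases lt_trichotomy x (c : ℕ) with h | h | h
        · exact absurd (Finset.mem_filter.2 ⟨hx, h⟩) (h2 ▸ Finset.notMem_empty x)
        · exact h
        · exact absurd (Finset.mem_filter.2 ⟨hx, h⟩) (h3 ▸ Finset.notMem_empty x)
      rw [geometricSeries_of_ne ψ _ h3, TensorProduct.tmul_zero, map_zero, map_zero]
    · rw [geometricSeries_of_ne ψ _ h2, TensorProduct.zero_tmul, map_zero, map_zero]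

/-! ### The two actions on the geometric series. -/

/-- The tuple obtained from `m` by replacing the entry in position `i` by the entries of `w`. -/
def insertBlock {M : Type*} {n q : ℕ} (i : Fin n) (m : Fin n → M) (w : Fin (q + 1) → M) :
    Fin (n + q) → M := fun p =>
  if h1 : p.1 < i.1 then m ⟨p, h1.trans i.2⟩
  else if h2 : p.1 ≤ i.1 + q then w ⟨p - i, by omega⟩
  else m ⟨p - q, by have := p.2; omega⟩

theorem insertBlock_lt {M : Type*} {n q : ℕ} (i : Fin n) (m : Fin n → M) (w : Fin (q + 1) → M)
    {j : Fin n} (hj : j < i) (hj' : j.1 < n + q) : insertBlock i m w ⟨j, hj'⟩ = m j :=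
  dif_pos hj

theorem insertBlock_mid {M : Type*} {n q : ℕ} (i : Fin n) (m : Fin n → M) (w : Fin (q + 1) → M)
    (l : Fin (q + 1)) (hl : i.1 + l.1 < n + q) : insertBlock i m w ⟨i + l, hl⟩ = w l := by
  unfold insertBlock
  rw [dif_neg (by simp), dif_pos (by have := l.2; simp only; omega)]
  congr 1
  ext
  simp

theorem insertBlock_gt {M : Type*} {n q : ℕ} (i : Fin n) (m : Fin n → M) (w : Fin (q + 1) → M)
    {j : Fin n} (hj : i < j) (hj' : j.1 + (q + 1) - 1 < n + q) :
    insertBlock i m w ⟨j + (q + 1) - 1, hj'⟩ = m j := by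
  have hj2 : i.1 < j.1 := hj
  unfold insertBlock
  rw [dif_neg (by simp only; omega), dif_neg (by simp only; omega)]
  congr 1
  ext
  simp only
  omega

/-- Tuples of arities of length `n + q` are obtained from those of length `n` by splitting the entry
in position `i` into `q + 1` entries. -/
theorem sum_antidiagonalTuple_insertBlock {M : Type*} [AddCommMonoid M] {n : ℕ} (i : Fin n)
    (q N : ℕ) (f : (Fin (n + q) → ℕ) → M) :
    ∑ m ∈ Finset.Nat.antidiagonalTuple (n + q) N, f m
      = ∑ m ∈ Finset.Nat.antidiagonalTuple n N,
        ∑ w ∈ Finset.Nat.antidiagonalTuple (q + 1) (m i), f (insertBlock i m w) := by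
  have hN : n + (q + 1) = (n + q) + 1 := by omega
  rw [Finset.sum_sigma']
  refine Finset.sum_bij'
    (fun m _ => ⟨fun j : Fin n =>
      if h1 : j < i then m ⟨j, by have := i.2; have : j.1 < i.1 := h1; omega⟩
      else if h2 : i < j then m ⟨j + (q + 1) - 1, by have := j.2; have : i.1 < j.1 := h2; omega⟩
      else ∑ l : Fin (q + 1), m ⟨i + l, by have := i.2; have := l.2; omega⟩,
      fun l => m ⟨i + l, by have := i.2; have := l.2; omega⟩⟩)
    (fun x _ => insertBlock i x.1 x.2) ?_ ?_ ?_ ?_ ?_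
  · intro m hm
    rw [Finset.Nat.mem_antidiagonalTuple] at hm
    simp only [Finset.mem_sigma, Finset.Nat.mem_antidiagonalTuple]
    exact ⟨(sum_spliceIndex hN i m).trans hm, by simp⟩
  · rintro ⟨m, w⟩ hx
    simp only [Finset.mem_sigma, Finset.Nat.mem_antidiagonalTuple] at hx
    rw [Finset.Nat.mem_antidiagonalTuple, ← sum_spliceIndex hN i, ← hx.1]
    refine Finset.sum_congr rfl fun j _ => ?_
    split_ifs with h1 h2
    · exact insertBlock_lt i m w h1 _
    · exact insertBlock_gt i m w h2 _
    · obtain rfl : j = i := le_antisymm (not_lt.1 h2) (not_lt.1 h1)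
      simp only [insertBlock_mid, hx.2]
  · intro m _
    funext p
    unfold insertBlock
    simp only [Fin.lt_def]
    split_ifs with h1 h2 h3 h4
    · rfl
    · congr 1
      ext
      simp only
      omega
    · omega
    · congr 1
      ext
      simp only
      omega
    · omega
  · rintro ⟨m, w⟩ hx
    simp only [Finset.mem_sigma, Finset.Nat.mem_antidiagonalTuple] at hx
    refine Sigma.ext ?_ (heq_of_eq ?_)
    · funext j
      dsimp only
      split_ifs with h1 h2
      · exact insertBlock_lt i m w h1 _
      · exact insertBlock_gt i m w h2 _
      · obtain rfl : j = i := le_antisymm (not_lt.1 h2) (not_lt.1 h1)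
        simp only [insertBlock_mid, hx.2]
    · funext l
      exact insertBlock_mid i m w l _
  · intro m _
    congr 1
    funext p
    unfold insertBlock
    simp only [Fin.lt_def]
    split_ifs with h1 h2 h3 h4
    · rfl
    · congr 1
      ext
      simp only
      omega
    · omega
    · congr 1
      ext
      simp only
      omega
    · omega

theorem componentWord_apply_of_ne (ψ : Cochain k A B) {n : ℕ} (m : Fin n → ℕ) (i : Fin n) (m' : ℕ)
    (h : m' ≠ m i) : componentWord ψ m i m' = 0 :=
  Pi.single_eq_of_ne h _

theorem plainComp_apply (h : Cochain k B B) (s : ℕ) (ψ : Fin s → Cochain k A B) (N : ℕ) :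
    plainComp h s ψ N = ∑ c : {c : Composition N // c.length = s},
      blockComp c.1 (h c.1.length) (fun j => ψ (Fin.cast c.2 j) (c.1.blocksFun j)) :=
  rfl

/-- A letter of `componentWord ψ w` accepts only blocks of its own arity, so a composition of `M`
meets exactly one tuple `w`, namely the tuple of its block lengths. -/
theorem sum_plainComp_componentWord (β : Cochain k B B) (ψ : Cochain k A B) (s M : ℕ) :
    ∑ w ∈ Finset.Nat.antidiagonalTuple s M, plainComp β s (componentWord ψ w)
      = Pi.single M (∑ c : {c : Composition M // c.length = s},
          blockComp c.1 (β c.1.length) (fun j => ψ (c.1.blocksFun j))) := by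
  funext N
  rw [Finset.sum_apply]
  by_cases hN : N = M
  swap
  · rw [Pi.single_eq_of_ne hN]
    refine Finset.sum_eq_zero fun w hw => ?_
    refine plainComp_apply_eq_zero β (componentWord_apply_of_ne ψ w) ?_
    rwa [Finset.Nat.mem_antidiagonalTuple.1 hw]
  · subst hN
    rw [Pi.single_eq_same]
    simp only [plainComp_apply]
    rw [Finset.sum_comm]
    refine Finset.sum_congr rfl fun c _ => ?_
    obtain ⟨c, rfl⟩ := c
    rw [Finset.sum_eq_single c.blocksFun]
    · congr 1
      funext j
      exact Pi.single_eq_same _ _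
    · intro w _ hw
      obtain ⟨j, hj⟩ := Function.ne_iff.1 hw
      ext x
      refine (β c.length).map_coord_zero j ?_
      change (componentWord ψ w j) (c.blocksFun j) _ = 0
      rw [componentWord_apply_of_ne ψ w j _ hj.symm]
      rfl
    · intro hc
      exact absurd (Finset.Nat.mem_antidiagonalTuple.2 c.sum_blocksFun) hc

/-- A composition of `M ≤ N` has at most `N` blocks, so truncating the sum at `N` loses nothing. The
sum starts with one block; the composition without blocks, which exists for `M = 0`, is harmless
because `β 0 = 0`. -/
theorem sum_range_plainComp {β : Cochain k B B} (hβ : β 0 = 0) (ψ : Cochain k A B) {M N : ℕ}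
    (hM : M ≤ N) :
    ∑ q ∈ Finset.range N, ∑ w ∈ Finset.Nat.antidiagonalTuple (q + 1) M,
      plainComp β (q + 1) (componentWord ψ w) = Pi.single M (compTilde β ψ M) := by
  simp only [sum_plainComp_componentWord]
  have h0 : ∀ l, l = 0 → β l = 0 := by rintro l rfl; exact hβ
  have hs : ∑ c : {c : Composition M // c.length = 0},
      blockComp c.1 (β c.1.length) (fun j => ψ (c.1.blocksFun j)) = 0 := by
    refine Finset.sum_eq_zero fun c _ => ?_
    ext x
    change β c.1.length _ = 0
    rw [h0 _ c.2]
    rfl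
  have key : ∑ s ∈ Finset.range (N + 1), ∑ c : {c : Composition M // c.length = s},
      blockComp c.1 (β c.1.length) (fun j => ψ (c.1.blocksFun j)) = compTilde β ψ M := by
    rw [compTilde, ← Finset.sum_fiberwise_of_maps_to (s := Finset.univ) (t := Finset.range (N + 1))
      (g := fun c : Composition M => c.length)]
    · refine Finset.sum_congr rfl fun s _ => ?_
      exact (Finset.sum_subtype (p := fun c => c.length = s)
        (Finset.univ.filter fun c : Composition M => c.length = s) (fun c => by simp)
        (fun c => blockComp c (β c.length) fun j => ψ (c.blocksFun j))).symm
    · intro c _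
      have := c.length_le
      exact Finset.mem_range.2 (by omega)
  rw [← key, Finset.sum_range_succ', hs, add_zero]
  exact (map_sum (AddMonoidHom.single (fun m => MultilinearMap k (fun _ : Fin m => A) B) M) _ _).symm

theorem brace_apply (d : ℤ) (α : Cochain k A A) (ψ : Cochain k A B) (N : ℕ) :
    brace 𝒜 d α ψ N = ∑ q : Fin N, ∑ r : Fin (N - q),
      splice (by have := q.2; omega : N - q + (q + 1) = N + 1) r (koszul 𝒜 d) (α (q + 1))
        (ψ (N - q)) :=
  rfl

theorem splice_zero {X Y : Type*} [AddCommGroup X] [Module k X] [AddCommGroup Y] [Module k Y]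
    {N n s : ℕ} (h : n + s = N + 1) (i : Fin n) (T : X →ₗ[k] X)
    (G : MultilinearMap k (fun _ : Fin n => X) Y) :
    splice h i T 0 G = 0 := by
  ext x
  refine G.map_coord_zero i ?_
  simp [spliceWord]

/-- Inserting the component of `α` of arity `q + 1` raises the arity by `q`; in arity `M` it
therefore meets just the component of `ψ` of arity `M - q`. -/
theorem sum_range_brace (d : ℤ) (α : Cochain k A A) (ψ : Cochain k A B) (M : ℕ) :
    ∑ q ∈ Finset.range M, brace 𝒜 d (Pi.single (q + 1) (α (q + 1)))
      (Pi.single (M - q) (ψ (M - q)))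
      = (Pi.single M (brace 𝒜 d α ψ M) : Cochain k A B) := by
  funext N
  rw [Finset.sum_apply]
  by_cases hN : N = M
  swap
  · rw [Pi.single_eq_of_ne hN]
    refine Finset.sum_eq_zero fun q hq => ?_
    have := Finset.mem_range.1 hq
    exact brace_single_apply_eq_zero 𝒜 d α q (m := M - q)
      (fun m' hm' => Pi.single_eq_of_ne hm' _) (by omega)
  · subst hN
    rw [Pi.single_eq_same, ← Fin.sum_univ_eq_sum_range (fun q => brace 𝒜 d
      (Pi.single (q + 1) (α (q + 1))) (Pi.single (N - q) (ψ (N - q)) : Cochain k A B) N)]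
    rw [brace_apply]
    refine Finset.sum_congr rfl fun q _ => ?_
    rw [brace_apply, Finset.sum_eq_single q]
    · simp only [Pi.single_eq_same]
    · intro t _ ht
      refine Finset.sum_eq_zero fun r _ => ?_
      rw [Pi.single_eq_of_ne (fun h => ht (Fin.ext (by omega))), splice_zero]
    · simp

/-- The words of total arity `N` in the components of `ψ`, with the letter in position `i` replaced
by a component of `φ`. -/
def replacedSeries (ψ φ : Cochain k A B) (n N : ℕ) : ⨂[k]^n (Cochain k A B) :=
  ∑ i : Fin n, ∑ m ∈ Finset.Nat.antidiagonalTuple n N,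
    PiTensorProduct.tprod k (Function.update (componentWord ψ m) i (Pi.single (m i) (φ (m i))))

theorem replacedSeries_sub (ψ φ φ' : Cochain k A B) (n N : ℕ) :
    replacedSeries ψ (φ - φ') n N = replacedSeries ψ φ n N - replacedSeries ψ φ' n N := by
  simp only [replacedSeries, ← Finset.sum_sub_distrib]
  refine Finset.sum_congr rfl fun i _ => Finset.sum_congr rfl fun m _ => ?_
  rw [Pi.sub_apply, Pi.single_sub]
  exact (PiTensorProduct.tprod k).map_update_sub _ _ _ _

theorem replacedSeries_zero (ψ : Cochain k A B) (n N : ℕ) : replacedSeries ψ 0 n N = 0 := by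
  refine Finset.sum_eq_zero fun i _ => Finset.sum_eq_zero fun m _ => ?_
  rw [Pi.zero_apply, Pi.single_zero]
  exact (PiTensorProduct.tprod k).map_update_zero _ _

/-- All letters have degree zero, so `tau` and the signs of `signedComp` act trivially, and splicing
merely composes the inserted block with `β`. -/
theorem spliceWord_componentWord_insertBlock [CharZero k] (β : Cochain k B B) {ψ : Cochain k A B}
    (hψ : ψ ∈ cochainDeg 𝒜 ℬ 0) (d : ℤ) {n q : ℕ} (h : n + (q + 1) = n + q + 1) (i : Fin n)
    (m : Fin n → ℕ) (w : Fin (q + 1) → ℕ) :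
    spliceWord h i (tau 𝒜 ℬ d) (signedComp 𝒜 ℬ β (q + 1)) (componentWord ψ (insertBlock i m w))
      = Function.update (componentWord ψ m) i (plainComp β (q + 1) (componentWord ψ w)) := by
  have hcongr : ∀ {a b : ℕ}, a = b → (Pi.single a (ψ a) : Cochain k A B) = Pi.single b (ψ b) := by
    rintro a b rfl
    rfl
  funext j
  unfold spliceWord
  split_ifs with h1 h2
  · rw [Function.update_of_ne h1.ne]
    exact (tau_eq_self 𝒜 ℬ (single_apply_mem 𝒜 ℬ hψ _)).trans (hcongr (insertBlock_lt i m w h1 _))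
  · rw [Function.update_of_ne h2.ne']
    exact hcongr (insertBlock_gt i m w h2 _)
  · obtain rfl : j = i := le_antisymm (not_lt.1 h2) (not_lt.1 h1)
    rw [Function.update_self, signedComp_eq_plainComp 𝒜 ℬ β (ψ := fun l => componentWord ψ _ _)
      (fun l => single_apply_mem 𝒜 ℬ hψ _)]
    congr 1
    funext l
    exact hcongr (insertBlock_mid j m w l _)

/-- Every word of `n + q` letters arises by splitting the arity in position `i` into `q + 1` parts.
Summing over the splittings and over `q` assembles `β ∘ ψ̃` in that position. -/
theorem leftAction_geometricSeries [CharZero k] (d : ℤ) {β : Cochain k B B} (hβ : β 0 = 0)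
    {ψ : Cochain k A B} (hψ : ψ ∈ cochainDeg 𝒜 ℬ 0) (n N : ℕ) :
    leftAction 𝒜 ℬ d β (geometricSeries ψ) n ∅ N = replacedSeries ψ (compTilde β ψ) n N := by
  rw [leftAction, Finset.sum_comm]
  refine Finset.sum_congr rfl fun i _ => ?_
  have hn : 0 < n := by have := i.2; omega
  have hterm : ∀ q, sgn k (d * (((∅ : Finset ℕ).filter (· ≤ (i : ℕ))).card : ℤ)) •
      PiTensorProduct.lift
        (splice (by omega : n + (q + 1) = (n + q) + 1) i (tau 𝒜 ℬ d) (signedComp 𝒜 ℬ β (q + 1))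
          (PiTensorProduct.tprod k))
        (geometricSeries ψ (n + q) ((∅ : Finset ℕ).image fun c => if c ≤ (i : ℕ) then c else c + q)
          N)
      = ∑ m ∈ Finset.Nat.antidiagonalTuple n N, ∑ w ∈ Finset.Nat.antidiagonalTuple (q + 1) (m i),
        PiTensorProduct.tprod k
          (Function.update (componentWord ψ m) i (plainComp β (q + 1) (componentWord ψ w))) := by
    intro q
    rw [Finset.filter_empty, Finset.card_empty, Nat.cast_zero, mul_zero, sgn_zero, one_smul,
      Finset.image_empty, geometricSeries_empty ψ (by omega), map_sum,
      sum_antidiagonalTuple_insertBlock i]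
    refine Finset.sum_congr rfl fun m _ => Finset.sum_congr rfl fun w _ => ?_
    rw [PiTensorProduct.lift.tprod]
    change PiTensorProduct.tprod k (spliceWord _ i _ _ _) = _
    rw [spliceWord_componentWord_insertBlock 𝒜 ℬ β hψ]
  rw [Finset.sum_congr rfl fun q _ => hterm q, Finset.sum_comm]
  refine Finset.sum_congr rfl fun m hm => ?_
  -- This bound makes the range of `q` large enough for all the compositions of `m i`.
  have hmi : m i ≤ N := by
    rw [← Finset.Nat.mem_antidiagonalTuple.1 hm]
    exact Finset.single_le_sum (fun _ _ => Nat.zero_le _) (Finset.mem_univ i)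
  rw [← sum_range_plainComp hβ ψ hmi]
  simp only [← MultilinearMap.toLinearMap_apply (PiTensorProduct.tprod k), map_sum]

/-- Tuples of total `N - q` are tuples of total `N` whose entry in position `i` is diminished
by `q`. -/
theorem sum_antidiagonalTuple_sub {M : Type*} [AddCommMonoid M] {n : ℕ} (i : Fin n)
    {q N : ℕ} (hq : q ≤ N) (f : (Fin n → ℕ) → M) :
    ∑ m ∈ Finset.Nat.antidiagonalTuple n (N - q), f m
      = ∑ m ∈ Finset.Nat.antidiagonalTuple n N with q ≤ m i,
        f (Function.update m i (m i - q)) := by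
  -- The additive form avoids truncated subtraction.
  have hsum : ∀ (m : Fin n → ℕ) (a : ℕ), ∑ j, Function.update m i a j + m i = ∑ j, m j + a := by
    intro m a
    rw [Finset.sum_update_of_mem (Finset.mem_univ i),
      ← Finset.add_sum_erase _ m (Finset.mem_univ i), Finset.sdiff_singleton_eq_erase]
    omega
  refine Finset.sum_bij' (fun m _ => Function.update m i (m i + q))
    (fun m _ => Function.update m i (m i - q)) ?_ ?_ ?_ ?_ ?_
  · intro m hm
    rw [Finset.Nat.mem_antidiagonalTuple] at hm
    rw [Finset.mem_filter, Finset.Nat.mem_antidiagonalTuple, Function.update_self]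
    have := hsum m (m i + q)
    omega
  · intro m hm
    rw [Finset.mem_filter, Finset.Nat.mem_antidiagonalTuple] at hm
    rw [Finset.Nat.mem_antidiagonalTuple]
    have := hsum m (m i - q)
    omega
  · intro m _
    simp
  · intro m hm
    have := (Finset.mem_filter.1 hm).2
    simp [Nat.sub_add_cancel this]
  · intro m _
    simp

theorem componentWord_update (ψ : Cochain k A B) {n : ℕ} (m : Fin n → ℕ) (i : Fin n) (a : ℕ) :
    componentWord ψ (Function.update m i a)
      = Function.update (componentWord ψ m) i (Pi.single a (ψ a)) := by
  funext j
  exact Function.apply_update (fun _ b => (Pi.single b (ψ b) : Cochain k A B)) m i a j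

/-- The minus sign is the factor `(-1)^g` of the right action for `g = α` of degree one. It turns
the sum of the two actions into the difference of the two sides of the morphism equation. -/
theorem rightAction_geometricSeries {α : Cochain k A A}
    {ψ : Cochain k A B} (hψ : ψ ∈ cochainDeg 𝒜 ℬ 0) (n N : ℕ) :
    rightAction 𝒜 ℬ 1 (geometricSeries ψ) α n ∅ N = -replacedSeries ψ (brace 𝒜 1 α ψ) n N := by
  rw [rightAction, Finset.sum_comm, replacedSeries, ← Finset.sum_neg_distrib]
  refine Finset.sum_congr rfl fun i _ => ?_
  have hn : 0 < n := by have := i.2; omega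
  have hterm : ∀ q ∈ Finset.range N,
      sgn k (1 * (1 + (((∅ : Finset ℕ).filter ((i : ℕ) < ·)).card : ℤ))) •
        PiTensorProduct.map (fun j : Fin n =>
          if j < i then LinearMap.id
          else if i < j then tau 𝒜 ℬ 1
          else brace 𝒜 1 (Pi.single (q + 1) (α (q + 1))))
        (geometricSeries ψ n ∅ (N - q))
      = -∑ m ∈ Finset.Nat.antidiagonalTuple n N, if q < m i then
        PiTensorProduct.tprod k
          (Function.update (componentWord ψ m) i (brace 𝒜 1 (Pi.single (q + 1) (α (q + 1)))
            (Pi.single (m i - q) (ψ (m i - q))))) else 0 := by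
    intro q hq
    rw [Finset.filter_empty, Finset.card_empty, Nat.cast_zero, add_zero, mul_one, sgn_one]
    have hneg : ∀ t : ⨂[k]^n (Cochain k A B), (-1 : k) • t = -t :=
      fun t => neg_one_smul k t
    rw [hneg, neg_inj]
    rw [geometricSeries_empty ψ hn, map_sum, sum_antidiagonalTuple_sub i (Finset.mem_range.1 hq).le,
      Finset.sum_filter]
    refine Finset.sum_congr rfl fun m _ => ?_
    have hword : (fun j : Fin n => (if j < i then LinearMap.id
          else if i < j then tau 𝒜 ℬ 1
          else brace 𝒜 1 (Pi.single (q + 1) (α (q + 1))))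
            (componentWord ψ (Function.update m i (m i - q)) j))
        = Function.update (componentWord ψ m) i (brace 𝒜 1 (Pi.single (q + 1) (α (q + 1)))
            (Pi.single (m i - q) (ψ (m i - q)))) := by
      funext j
      rw [componentWord_update]
      rcases lt_trichotomy j i with h | rfl | h
      · rw [if_pos h, Function.update_of_ne h.ne, Function.update_of_ne h.ne, LinearMap.id_apply]
      · rw [if_neg (lt_irrefl _), if_neg (lt_irrefl _), Function.update_self, Function.update_self]
      · rw [if_neg h.not_gt, if_pos h, Function.update_of_ne h.ne', Function.update_of_ne h.ne']
        exact tau_eq_self 𝒜 ℬ (single_apply_mem 𝒜 ℬ hψ _)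
    rw [PiTensorProduct.map_tprod, hword]
    rcases lt_trichotomy q (m i) with h | h | h
    · rw [if_pos h, if_pos h.le]
    -- The boundary case `q = m i` would use the component of `ψ` of arity zero, which vanishes.
    · rw [if_pos h.le, if_neg (by omega)]
      have h0 : (Pi.single (m i - q) (ψ (m i - q)) : Cochain k A B) = 0 := by
        rw [show m i - q = 0 by omega, hψ.1, Pi.single_zero]
      rw [h0, map_zero]
      exact (PiTensorProduct.tprod k).map_update_zero _ _
    · rw [if_neg (by omega), if_neg (by omega)]
  rw [Finset.sum_congr rfl hterm, Finset.sum_neg_distrib, Finset.sum_comm]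
  congr 1
  refine Finset.sum_congr rfl fun m hm => ?_
  have hmi : m i ≤ N := by
    rw [← Finset.Nat.mem_antidiagonalTuple.1 hm]
    exact Finset.single_le_sum (fun _ _ => Nat.zero_le _) (Finset.mem_univ i)
  rw [← Finset.sum_filter, ← sum_range_brace]
  have hr : (Finset.range N).filter (fun q => q < m i) = Finset.range (m i) := by
    ext q
    simp only [Finset.mem_filter, Finset.mem_range]
    omega
  rw [hr]
  simp only [← MultilinearMap.toLinearMap_apply (PiTensorProduct.tprod k), map_sum]

/-- The renumbering of the cuts is injective, so the left action preserves the number of blocks. -/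
theorem leftAction_apply_eq_zero (d : ℤ) (h : Cochain k B B) {x : CobarFamily k A B} {p : ℕ}
    (hx : ∀ n S N, S.card = p → x n S N = 0) {n : ℕ} {S : Finset ℕ} {N : ℕ} (hS : S.card = p) :
    leftAction 𝒜 ℬ d h x n S N = 0 := by
  refine Finset.sum_eq_zero fun q _ => Finset.sum_eq_zero fun i _ => ?_
  rw [hx, map_zero, smul_zero]
  rw [Finset.card_image_of_injective _ ?_, hS]
  intro a b hab
  simp only at hab
  split_ifs at hab <;> omega

theorem rightAction_apply_eq_zero (d : ℤ) (g : Cochain k A A) {x : CobarFamily k A B} {n : ℕ}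
    {S : Finset ℕ} (hx : ∀ N, x n S N = 0) (N : ℕ) : rightAction 𝒜 ℬ d x g n S N = 0 := by
  refine Finset.sum_eq_zero fun q _ => Finset.sum_eq_zero fun i _ => ?_
  rw [hx, map_zero, smul_zero]

theorem actions_geometricSeries [CharZero k] {α : Cochain k A A} {β : Cochain k B B}
    (hβ : β 0 = 0) {ψ : Cochain k A B} (hψ : ψ ∈ cochainDeg 𝒜 ℬ 0) (n : ℕ) (S : Finset ℕ) (N : ℕ) :
    (leftAction 𝒜 ℬ 1 β (geometricSeries ψ) + rightAction 𝒜 ℬ 1 (geometricSeries ψ) α) n S N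
      = if S = ∅ then replacedSeries ψ (compTilde β ψ - brace 𝒜 1 α ψ) n N else 0 := by
  simp only [Pi.add_apply]
  split_ifs with hS
  · subst hS
    rw [leftAction_geometricSeries 𝒜 ℬ 1 hβ hψ, rightAction_geometricSeries 𝒜 ℬ hψ,
      replacedSeries_sub, sub_eq_add_neg]
  · rw [rightAction_apply_eq_zero 𝒜 ℬ 1 α (geometricSeries_of_ne ψ n hS),
      leftAction_apply_eq_zero 𝒜 ℬ 1 β (p := S.card) (fun n' S' N' h => ?_) rfl, add_zero]
    refine geometricSeries_of_ne ψ n' (fun h' => hS ?_) N'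
    rw [h', Finset.card_empty] at h
    exact Finset.card_eq_zero.1 h.symm

/-! ### The components of the Maurer–Cartan equation, and the descent on the number of blocks. -/

theorem mem_maurerCartanSet_iff [CharZero k] (l : L 𝒜 ℬ 1) :
    l ∈ maurerCartanSet 𝒜 ℬ ↔ brace 𝒜 1 l.1.1 l.1.1 = 0 ∧ brace ℬ 1 l.1.2.1 l.1.2.1 = 0 ∧
      cobarDiff 𝒜 ℬ l.1.2.2 + (cobarMul l.1.2.2 l.1.2.2 + leftAction 𝒜 ℬ 1 l.1.2.1 l.1.2.2
        + rightAction 𝒜 ℬ 1 l.1.2.2 l.1.1) = 0 := by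
  -- In degree one both terms of the bracket coincide, and the factor `1/2` removes the resulting
  -- `2`.
  have hsgn : sgn k (1 * 1 + 1) = 1 := by rw [sgn_add, mul_one, sgn_mul_self]
  have hval : (differential 𝒜 ℬ l + (2⁻¹ : k) • bracket 𝒜 ℬ l l).1
      = d1 𝒜 ℬ l.1 + b11 𝒜 ℬ 1 1 l.1 l.1 := by
    change d1 𝒜 ℬ l.1 + (2⁻¹ : k) • (b11 𝒜 ℬ 1 1 l.1 l.1 + sgn k (1 * 1 + 1) •
      b11 𝒜 ℬ 1 1 l.1 l.1) = _
    rw [hsgn, one_smul, ← two_smul k (b11 𝒜 ℬ 1 1 l.1 l.1), smul_smul,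
      inv_mul_cancel₀ two_ne_zero, one_smul]
  rw [maurerCartanSet, Set.mem_ofPred_eq, ← Subtype.val_inj, hval]
  change d1 𝒜 ℬ l.1 + b11 𝒜 ℬ 1 1 l.1 l.1 = 0 ↔ _
  rw [Prod.ext_iff, Prod.ext_iff]
  simp only [d1, b11, Prod.fst_add, Prod.snd_add, zero_add, Prod.fst_zero, Prod.snd_zero]

theorem apply_eq_zero_of_not_valid {d : ℤ} {x : CobarFamily k A B} (hx : x ∈ cobarDeg 𝒜 ℬ d)
    {n : ℕ} {S : Finset ℕ} (h : ¬(0 < n ∧ S ⊆ Finset.Ioo 0 n)) (N : ℕ) : x n S N = 0 := by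
  have := hx.1 n S N
  rwa [cobarPiece, if_neg h, Submodule.mem_bot] at this

/-- If all the components of `γ` with more than `Q + 1` blocks vanish, then the square of `γ` detects
the components with `Q + 1` blocks. -/
theorem eq_zero_of_cobarMul_self {x : CobarFamily k A B} {Q : ℕ}
    (hQ : ∀ n S N, Q < S.card → x n S N = 0)
    (hmul : ∀ n S N, S.card = 2 * Q + 1 → cobarMul x x n S N = 0) {n : ℕ} {S : Finset ℕ}
    (hS : S.card = Q) (hn : 0 < n) (hSn : S ⊆ Finset.Ioo 0 n) (N : ℕ) : x n S N = 0 := by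
  induction N using Nat.strong_induction_on with
  | _ N ih =>
    -- The square is tested on words of `2n` letters with the cut pattern `S`, then `n`, then `S`
    -- shifted by `n`. At the cut `n` and the arities `(N, N)` it contributes `x n S N ⊗ x n S N`,
    -- and every other contribution vanishes.
    let S' : Finset ℕ := S.image (· + n)
    have hS' : ∀ a ∈ S', n < a := by
      intro a ha
      obtain ⟨b, hb, rfl⟩ := Finset.mem_image.1 ha
      have := Finset.mem_Ioo.1 (hSn hb)
      omega
    have hlt : ∀ a ∈ S, a < n := fun a ha => (Finset.mem_Ioo.1 (hSn ha)).2
    have hcS' : S'.card = Q := by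
      rw [Finset.card_image_of_injective _ (add_left_injective n), hS]
    let R : Finset ℕ := insert n (S ∪ S')
    have hR : R.card = 2 * Q + 1 := by
      rw [Finset.card_insert_of_notMem, Finset.card_union_of_disjoint, hS, hcS']
      · omega
      · rw [Finset.disjoint_left]
        intro a ha ha'
        exact absurd (hlt a ha) (hS' a ha').not_gt
      · intro h
        rcases Finset.mem_union.1 h with h | h
        · exact (hlt n h).false
        · exact (hS' n h).false
    have hleft : R.filter (· < n) = S := by
      ext a
      simp only [R, Finset.mem_filter, Finset.mem_insert, Finset.mem_union]
      constructor
      · rintro ⟨rfl | h | h, h'⟩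
        · exact absurd h' (lt_irrefl _)
        · exact h
        · exact absurd h' (hS' a h).not_gt
      · exact fun h => ⟨Or.inr (Or.inl h), hlt a h⟩
    have hright : (R.filter (n < ·)).image (· - n) = S := by
      have : R.filter (n < ·) = S' := by
        ext a
        simp only [R, Finset.mem_filter, Finset.mem_insert, Finset.mem_union]
        constructor
        · rintro ⟨rfl | h | h, h'⟩
          · exact absurd h' (lt_irrefl _)
          · exact absurd h' (hlt a h).not_gt
          · exact h
        · exact fun h => ⟨Or.inr (Or.inr h), hS' a h⟩
      rw [this, Finset.image_image]
      simp [Function.comp_def]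
    have h0 := hmul (n + n) R (N + N) hR
    have hnn : n < n + n := by omega
    rw [cobarMul, Finset.sum_eq_single ⟨n, hnn⟩] at h0
    · rw [if_pos ⟨hn, Finset.mem_insert_self _ _⟩, Finset.sum_eq_single (N, N)] at h0
      · simp only [hleft, hright] at h0
        rw [LinearEquiv.map_eq_zero_iff, LinearEquiv.map_eq_zero_iff] at h0
        have hdiff : n + n - n = n := Nat.add_sub_cancel n n
        rw [hdiff] at h0
        exact tmul_self_eq_zero h0
      -- If `p + q = 2N` and `(p, q) ≠ (N, N)`, one of the two arities is below `N`, where the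
      -- induction hypothesis applies.
      · rintro ⟨p, q⟩ hp hne
        have hpq : p + q = N + N := Finset.HasAntidiagonal.mem_antidiagonal.1 hp
        have hdiff : n + n - n = n := Nat.add_sub_cancel n n
        simp only [hleft, hright]
        rcases lt_or_ge p N with h | h
        · rw [ih p h, TensorProduct.zero_tmul, map_zero, map_zero]
        · have hq : q < N := by
            by_contra hq
            exact hne (Prod.ext (by simp only; omega) (by simp only; omega))
          have hq0 : x (n + n - n) S q = 0 := by
            rw [hdiff]
            exact ih q hq
          rw [hq0, TensorProduct.tmul_zero, map_zero, map_zero]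
      · intro h
        exact absurd (Finset.HasAntidiagonal.mem_antidiagonal (a := (N, N)).2 rfl) h
    · intro c _ hc
      have hcn : (c : ℕ) ≠ n := fun h => hc (Fin.ext h)
      split_ifs with hcR
      swap
      · rfl
      refine Finset.sum_eq_zero fun p _ => ?_
      -- A cut before `n` leaves `n` and all of `S'` in the right factor, and a cut after `n` leaves
      -- `n` and all of `S` in the left one: at least `Q + 1` cuts in either case.
      rcases lt_or_gt_of_ne hcn with h | h
      · have : Q < ((R.filter ((c : ℕ) < ·)).image (· - (c : ℕ))).card := by
          rw [Finset.card_image_of_injOn]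
          · rw [← hcS', Nat.lt_iff_add_one_le, ← Finset.card_insert_of_notMem
              (fun h' => (hS' n h').false)]
            refine Finset.card_le_card fun a ha => ?_
            rcases Finset.mem_insert.1 ha with rfl | ha
            · exact Finset.mem_filter.2 ⟨Finset.mem_insert_self _ _, h⟩
            · exact Finset.mem_filter.2 ⟨Finset.mem_insert_of_mem (Finset.mem_union_right _ ha),
                h.trans (hS' a ha)⟩
          · intro a ha b hb hab
            have ha' := (Finset.mem_filter.1 (Finset.mem_coe.1 ha)).2
            have hb' := (Finset.mem_filter.1 (Finset.mem_coe.1 hb)).2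
            simp only at hab
            omega
        rw [hQ _ _ _ this, TensorProduct.tmul_zero, map_zero, map_zero]
      · have : Q < (R.filter (· < (c : ℕ))).card := by
          rw [← hS, Nat.lt_iff_add_one_le, ← Finset.card_insert_of_notMem
            (fun h' => (hlt n h').false)]
          refine Finset.card_le_card fun a ha => ?_
          rcases Finset.mem_insert.1 ha with rfl | ha
          · exact Finset.mem_filter.2 ⟨Finset.mem_insert_self _ _, h⟩
          · exact Finset.mem_filter.2 ⟨Finset.mem_insert_of_mem (Finset.mem_union_left _ ha),
              (hlt a ha).trans h⟩
        rw [hQ _ _ _ this, TensorProduct.zero_tmul, map_zero, map_zero]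
    · intro h
      exact absurd (Finset.mem_univ _) h

/-- A solution of the Maurer–Cartan equation is concentrated in words with a single block. -/
theorem apply_eq_zero_of_maurerCartan {d : ℤ} {x : CobarFamily k A B} (hx : x ∈ cobarDeg 𝒜 ℬ d)
    {α : Cochain k A A} {β : Cochain k B B}
    (h : cobarDiff 𝒜 ℬ x + (cobarMul x x + leftAction 𝒜 ℬ 1 β x + rightAction 𝒜 ℬ 1 x α) = 0)
    (n : ℕ) {S : Finset ℕ} (hS : S ≠ ∅) (N : ℕ) : x n S N = 0 := by
  obtain ⟨P, hP⟩ := hx.2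
  -- Elements of the cobar construction have boundedly many blocks, which provides the start of a
  -- descending induction on the number of cuts.
  suffices H : ∀ Q, (∀ n S N, Q < S.card → x n S N = 0) → ∀ n S N, 0 < S.card → x n S N = 0 from
    H P (fun n S N hS => hP n S N (by omega)) n S N (Finset.card_pos.2
      (Finset.nonempty_iff_ne_empty.2 hS))
  intro Q
  induction Q with
  | zero => exact fun h => h
  | succ Q ih =>
    intro hQ
    refine ih fun n S N hS => ?_
    rcases (Nat.succ_le_of_lt hS).lt_or_eq with hS | hS
    · exact hQ n S N hS
    · by_cases hv : 0 < n ∧ S ⊆ Finset.Ioo 0 n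
      swap
      · exact apply_eq_zero_of_not_valid 𝒜 ℬ hx hv N
      refine eq_zero_of_cobarMul_self hQ (fun n S N hS => ?_) hS.symm hv.1 hv.2 N
      have h' := congrFun (congrFun (congrFun h n) S) N
      simp only [Pi.add_apply, Pi.zero_apply] at h'
      -- Here `S` has `2(Q + 1) + 1` cuts and removing one leaves `2(Q + 1) > Q + 1`. This
      -- inequality would fail for the top number of cuts `0`, so the descent stops at single
      -- blocks.
      have hdiff : cobarDiff 𝒜 ℬ x n S N = 0 := by
        refine Finset.sum_eq_zero fun c _ => ?_
        split_ifs with hc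
        · have := Finset.card_erase_add_one hc.2
          rw [hQ n (S.erase c) N (by omega), map_zero, smul_zero]
        · rfl
      rwa [hdiff, rightAction_apply_eq_zero 𝒜 ℬ 1 α (fun N => hQ n S N (by omega)),
        leftAction_apply_eq_zero 𝒜 ℬ 1 β (p := S.card) (fun n' S' N' h => hQ n' S' N' (by omega))
          rfl, zero_add, add_zero, add_zero] at h'

/-! ### Reconstruction of a one-block solution from its one-letter words. -/

theorem map_tau_map_tau {n : ℕ} (p : Fin n → Prop) [DecidablePred p] (t : ⨂[k]^n (Cochain k A B)) :
    PiTensorProduct.map (fun i => if p i then tau 𝒜 ℬ 1 else LinearMap.id)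
      (PiTensorProduct.map (fun i => if p i then tau 𝒜 ℬ 1 else LinearMap.id) t) = t := by
  rw [← LinearMap.comp_apply, ← PiTensorProduct.map_comp]
  have : (fun i : Fin n => (if p i then tau 𝒜 ℬ 1 else LinearMap.id : Cochain k A B →ₗ[k] _) ∘ₗ
      (if p i then tau 𝒜 ℬ 1 else LinearMap.id)) = fun _ => LinearMap.id := by
    funext i
    split_ifs
    · exact LinearMap.ext fun f => tau_tau 𝒜 ℬ 1 f
    · rfl
  rw [this, PiTensorProduct.map_id, LinearMap.id_apply]

/-- A solution of `δ γ + γ γ = 0` concentrated in words with a single block is determined by its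
words with a single letter. -/
theorem eq_geometricSeries {d : ℤ} {x : CobarFamily k A B} (hx : x ∈ cobarDeg 𝒜 ℬ d)
    (hone : ∀ n S N, S ≠ ∅ → x n S N = 0)
    (hmul : ∀ n S N, S ≠ ∅ → cobarDiff 𝒜 ℬ x n S N + cobarMul x x n S N = 0)
    {ψ : Cochain k A B} (hψ : ψ ∈ cochainDeg 𝒜 ℬ 0)
    (hlin : ∀ N, x 1 ∅ N = geometricSeries ψ 1 ∅ N) : x = geometricSeries ψ := by
  funext n S N
  by_cases hS : S = ∅
  swap
  · rw [hone n S N hS, geometricSeries_of_ne ψ n hS]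
  subst hS
  rcases Nat.eq_zero_or_pos n with rfl | hn
  · rw [apply_eq_zero_of_not_valid 𝒜 ℬ hx (fun h => lt_irrefl 0 h.1)]
    exact (if_neg fun h => lt_irrefl 0 h.1).symm
  induction n, hn using Nat.le_induction generalizing N with
  | base => exact hlin N
  | succ n hn ih =>
    -- The equation at the single cut `{1}` gives a recursion for the words of `n + 1` letters. It
    -- is stated for arbitrary `y` so that it applies both to `x` and to the geometric series.
    have h1 : ∀ y : CobarFamily k A B, (∀ n S N, S ≠ ∅ → cobarDiff 𝒜 ℬ y n S N
        + cobarMul y y n S N = 0) →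
        PiTensorProduct.map (fun i => if i < (⟨1, by omega⟩ : Fin (n + 1)) then tau 𝒜 ℬ 1
          else LinearMap.id) (y (n + 1) ∅ N)
        = ∑ p ∈ Finset.HasAntidiagonal.antidiagonal N,
          TensorPower.cast k (Cochain k A B) (by omega : 1 + (n + 1 - 1) = n + 1)
            (TensorPower.mulEquiv (y 1 ∅ p.1 ⊗ₜ[k] y (n + 1 - 1) ∅ p.2)) := by
      intro y hy
      have := hy (n + 1) {1} N (Finset.singleton_ne_empty 1)
      rw [cobarDiff, cobarMul, Finset.sum_eq_single ⟨1, by omega⟩,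
        Finset.sum_eq_single ⟨1, by omega⟩, if_pos ⟨one_pos, Finset.mem_singleton_self 1⟩,
        if_pos ⟨one_pos, Finset.mem_singleton_self 1⟩] at this
      · simp only [filter_lt_singleton, filter_gt_singleton, Finset.image_empty, Finset.card_empty,
          Nat.cast_zero, add_zero, sgn_one, Finset.erase_singleton] at this
        have hneg : ∀ t : ⨂[k]^(n + 1) (Cochain k A B), (-1 : k) • t = -t :=
          fun t => neg_one_smul k t
        rw [hneg] at this
        exact neg_add_eq_zero.1 this
      all_goals first
        | exact fun c _ hc => if_neg fun h => hc (Fin.ext (Finset.mem_singleton.1 h.2))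
        | exact fun h => absurd (Finset.mem_univ _) h
    have hyp : ∀ p, x 1 ∅ p = geometricSeries ψ 1 ∅ p := hlin
    have h2 := h1 x hmul
    have h3 := h1 (geometricSeries ψ) fun n S N _ =>
      congrFun (congrFun (congrFun (cobarDiff_add_cobarMul_geometricSeries 𝒜 ℬ hψ) n) S) N
    have h4 : ∀ p, x (n + 1 - 1) ∅ p = geometricSeries ψ (n + 1 - 1) ∅ p := ih
    simp only [hyp, h4] at h2
    rw [← h3] at h2
    -- The sign operator on the first letter is an involution, so it can be cancelled from the
    -- recursion.
    have h5 := map_tau_map_tau 𝒜 ℬ (fun i : Fin (n + 1) => i < ⟨1, by omega⟩)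
    rw [← h5 (x (n + 1) ∅ N), h2, h5]

theorem geometricSeries_one (ψ : Cochain k A B) (N : ℕ) :
    geometricSeries ψ 1 ∅ N = PiTensorProduct.tprod k fun _ => Pi.single N (ψ N) := by
  rw [geometricSeries_empty ψ one_pos, Finset.Nat.antidiagonalTuple_one, Finset.sum_singleton]
  congr 1
  funext i
  obtain rfl : i = 0 := Subsingleton.elim _ _
  rfl

theorem replacedSeries_one (ψ φ : Cochain k A B) (N : ℕ) :
    replacedSeries ψ φ 1 N = PiTensorProduct.tprod k fun _ => Pi.single N (φ N) := by
  rw [replacedSeries, Finset.Nat.antidiagonalTuple_one, Fin.sum_univ_one, Finset.sum_singleton]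
  congr 1
  funext i
  obtain rfl : i = 0 := Subsingleton.elim _ _
  exact Function.update_self _ _ _

theorem apply_eq_of_tprod_single_eq {φ φ' : Cochain k A B} {N : ℕ}
    (h : PiTensorProduct.tprod k (fun _ : Fin 1 => (Pi.single N (φ N) : Cochain k A B))
      = PiTensorProduct.tprod k fun _ => Pi.single N (φ' N)) : φ N = φ' N := by
  have := congrArg (PiTensorProduct.subsingletonEquiv (0 : Fin 1)) h
  rw [PiTensorProduct.subsingletonEquiv_apply_tprod,
    PiTensorProduct.subsingletonEquiv_apply_tprod] at this
  exact Pi.single_injective N this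

/-- The words with a single letter of an element of degree one of the cobar construction are the
components of a cochain of degree zero. -/
theorem exists_cochain_of_mem_cobarDeg {x : CobarFamily k A B} (hx : x ∈ cobarDeg 𝒜 ℬ 1) :
    ∃ ψ ∈ cochainDeg 𝒜 ℬ 0, ∀ N, x 1 ∅ N = geometricSeries ψ 1 ∅ N := by
  let ev : (⨂[k]^1 (Cochain k A B)) ≃ₗ[k] Cochain k A B := PiTensorProduct.subsingletonEquiv 0
  have hdeg : ∀ N, ev (x 1 ∅ N) ∈ cochainDeg 𝒜 ℬ 0 := fun N => by
    refine map_mem_of_mem_cobarPiece 𝒜 ℬ _ ev.toLinearMap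
      (fun _ _ e m ψ he hm hψ => ?_) (hx.1 1 ∅ N)
    -- The single desuspension accounts for the total degree one, so the letter has degree zero.
    have h0 := (hψ 0).1
    rw [Fin.sum_univ_one, Finset.card_empty] at he
    rw [show e 0 = 0 by simpa using he] at h0
    have : ev (PiTensorProduct.tprod k ψ) = ψ 0 :=
      PiTensorProduct.subsingletonEquiv_apply_tprod 0 ψ
    exact this ▸ h0
  have hsupp : ∀ N m', m' ≠ N → ev (x 1 ∅ N) m' = 0 := fun N m' hm' => by
    refine map_mem_of_mem_cobarPiece 𝒜 ℬ (LinearMap.ker (LinearMap.proj (R := k)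
      (φ := fun m => MultilinearMap k (fun _ : Fin m => A) B) m')) ev.toLinearMap
      (fun _ _ e m ψ he hm hψ => ?_) (hx.1 1 ∅ N)
    rw [Fin.sum_univ_one] at hm
    have : ev (PiTensorProduct.tprod k ψ) = ψ 0 :=
      PiTensorProduct.subsingletonEquiv_apply_tprod 0 ψ
    change ev (PiTensorProduct.tprod k ψ) m' = 0
    rw [this]
    exact (hψ 0).2 m' (hm ▸ hm')
  -- The one-letter word of total arity `N` supplies the component of `ψ` of arity `N`; the
  -- conditions on degrees concern each arity separately.
  refine ⟨fun N => ev (x 1 ∅ N) N, ⟨(hdeg 0).1, fun m => (hdeg m).2 m⟩, fun N => ?_⟩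
  rw [geometricSeries_one]
  apply ev.injective
  have : ev (PiTensorProduct.tprod k fun _ => Pi.single N (ev (x 1 ∅ N) N))
      = Pi.single N (ev (x 1 ∅ N) N) := PiTensorProduct.subsingletonEquiv_apply_tprod 0 _
  rw [this]
  funext m'
  by_cases h : m' = N
  · subst h
    rw [Pi.single_eq_same]
  · rw [Pi.single_eq_of_ne h, hsupp N m' h]

theorem geometricSeries_injective :
    Function.Injective (geometricSeries : Cochain k A B → CobarFamily k A B) := by
  intro ψ ψ' h
  funext N
  refine apply_eq_of_tprod_single_eq (N := N) ?_
  rw [← geometricSeries_one, ← geometricSeries_one, h]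

/-- For a geometric series, the `Γ̄`-component of the Maurer–Cartan equation says that `ψ` is a
morphism. -/
theorem maurerCartan_geometricSeries_iff [CharZero k] {α : Cochain k A A} {β : Cochain k B B}
    (hβ : β 0 = 0) {ψ : Cochain k A B} (hψ : ψ ∈ cochainDeg 𝒜 ℬ 0) :
    cobarDiff 𝒜 ℬ (geometricSeries ψ) + (cobarMul (geometricSeries ψ) (geometricSeries ψ)
        + leftAction 𝒜 ℬ 1 β (geometricSeries ψ) + rightAction 𝒜 ℬ 1 (geometricSeries ψ) α) = 0
      ↔ brace 𝒜 1 α ψ = compTilde β ψ := by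
  rw [add_assoc, ← add_assoc, cobarDiff_add_cobarMul_geometricSeries 𝒜 ℬ hψ, zero_add]
  constructor
  · intro h
    funext N
    -- For one letter there is nothing besides the replaced letter, so the difference of the two
    -- sides of the morphism equation can be read off.
    have hN := congrFun (congrFun (congrFun h 1) ∅) N
    rw [actions_geometricSeries 𝒜 ℬ hβ hψ, if_pos rfl, replacedSeries_sub, replacedSeries_one,
      replacedSeries_one] at hN
    exact (apply_eq_of_tprod_single_eq (sub_eq_zero.1 hN)).symm
  · intro h
    funext n S N
    rw [actions_geometricSeries 𝒜 ℬ hβ hψ, h, sub_self, replacedSeries_zero, ite_self]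
    rfl

/-! ### The bijection. -/

theorem toLie_mem_maurerCartanSet [CharZero k] (t : AInfTriple 𝒜 ℬ) :
    t.toLie 𝒜 ℬ ∈ maurerCartanSet 𝒜 ℬ :=
  (mem_maurerCartanSet_iff 𝒜 ℬ _).2 ⟨t.isAlgebra_α.2, t.isAlgebra_β.2,
    (maurerCartan_geometricSeries_iff 𝒜 ℬ t.isAlgebra_β.1.1 t.isMorphism_ψ.1).2
      t.isMorphism_ψ.2⟩

theorem toLie_injective : Function.Injective (AInfTriple.toLie 𝒜 ℬ) := by
  rintro ⟨α, β, ψ, _, _, _⟩ ⟨α', β', ψ', _, _, _⟩ h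
  have h' : (α, β, geometricSeries ψ) = (α', β', geometricSeries ψ') := congrArg Subtype.val h
  simp only [Prod.mk.injEq] at h'
  obtain ⟨rfl, rfl, h'⟩ := h'
  obtain rfl := geometricSeries_injective h'
  rfl

theorem exists_toLie_eq [CharZero k] {l : L 𝒜 ℬ 1} (hl : l ∈ maurerCartanSet 𝒜 ℬ) :
    ∃ t : AInfTriple 𝒜 ℬ, t.toLie 𝒜 ℬ = l := by
  obtain ⟨hα, hβ, hγ⟩ := (mem_maurerCartanSet_iff 𝒜 ℬ l).1 hl
  obtain ⟨⟨α, β, γ⟩, hαd, hβd, hγd⟩ := l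
  dsimp only at hα hβ hγ hαd hβd hγd
  obtain ⟨ψ, hψ, hlin⟩ := exists_cochain_of_mem_cobarDeg 𝒜 ℬ hγd
  have hone : ∀ n S N, S ≠ ∅ → γ n S N = 0 := fun n S N hS =>
    apply_eq_zero_of_maurerCartan 𝒜 ℬ hγd hγ n hS N
  obtain rfl : γ = geometricSeries ψ := by
    refine eq_geometricSeries 𝒜 ℬ hγd hone (fun n S N hS => ?_) hψ hlin
    have h := congrFun (congrFun (congrFun hγ n) S) N
    simp only [Pi.add_apply, Pi.zero_apply] at h
    -- Both actions preserve the number of cuts, so wherever there is a cut the equation reduces to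
    -- `δγ + γγ = 0`.
    rwa [rightAction_apply_eq_zero 𝒜 ℬ 1 α (fun N => hone n S N hS),
      leftAction_apply_eq_zero 𝒜 ℬ 1 β (p := S.card) (fun n' S' N' h => hone n' S' N' ?_) rfl,
      add_zero, add_zero] at h
    rintro rfl
    rw [Finset.card_empty] at h
    exact hS (Finset.card_eq_zero.1 h.symm)
  exact ⟨⟨α, β, ψ, ⟨hαd, hα⟩, ⟨hβd, hβ⟩, hψ,
    (maurerCartan_geometricSeries_iff 𝒜 ℬ hβd.1 hψ).1 hγ⟩, rfl⟩

end MaurerCartan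

end AInfMor

end

theorem mainTheorem3 {k : Type*} [Field k] [CharZero k]
    {A : Type*} [AddCommGroup A] [Module k A] (𝒜 : ℤ → Submodule k A) [DirectSum.Decomposition 𝒜]
    {B : Type*} [AddCommGroup B] [Module k B] (ℬ : ℤ → Submodule k B) [DirectSum.Decomposition ℬ] :
    Set.BijOn (AInfMor.AInfTriple.toLie 𝒜 ℬ) Set.univ (AInfMor.maurerCartanSet 𝒜 ℬ) :=
  ⟨fun t _ => AInfMor.toLie_mem_maurerCartanSet 𝒜 ℬ t, (AInfMor.toLie_injective 𝒜 ℬ).injOn,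
    fun _ hl => (AInfMor.exists_toLie_eq 𝒜 ℬ hl).imp fun _ ht => ⟨Set.mem_univ _, ht⟩⟩
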